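/- **Setting.** Let $\mathcal I$ be a category with finite limits, regarded as a cartesian monoidal category. A *monoidal bifibration* over $\mathcal I$ is a functor $p:\mathcal E\to\mathcal I$ that is both a fibration and an opfibration and is strict monoidal for a monoidal structure on $\mathcal E$ whose tensor product preserves cartesian and opcartesian arrows. It is *Beck–Chevalley* if the following holds for every commutative square $r\circ t=b\circ l$ in $\mathcal E$, with $t:W\to X$, $l:W\to Z$, $r:X\to Y$, $b:Z\to Y$, lying over a pullback square of $\mathcal I$: if $l$ and $r$ are cartesian and $b$ is opcartesian, then $t$ is opcartesian. Let $\mathcal M,\mathcal C,\mathcal D\to\mathcal I$ be Beck–Chevalley monoidal bifibrations, with fibres $\mathcal M_I,\mathcal C_I,\mathcal D_I$, reindexing functors $f^*$ and pushforward functors $f^!$ left adjoint to $f^*$. Let $\mathcal M$ act (on the left, written $\bullet$) on $\mathcal C$ and on $\mathcal D$ by *fibractions*: actions lying strictly over the cartesian product of $\mathcal I$ and preserving cartesian and opcartesian arrows. The induced action of $\mathcal M_S$ on $\mathcal C_S$ is the restriction of the external action along the diagonal of $S$; it is also written $\bullet$. **Matrices.** $\mathbf{Mat}_{\mathcal I}(\mathcal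 M)$ is the bicategory whose objects are the objects of $\mathcal I$, whose 1-cells $I\to J$ are the objects of $\mathcal M_{I\times J}$, and whose 2-cells are the morphisms of these fibres. The composite of $M\in\mathcal M_{I\times J}$ and $N\in\mathcal M_{J\times K}$ is obtained from the external tensor product $M\otimes N$ by reindexing along $(i,j,k)\mapsto((i,j),(j,k))$ and pushing forward along $(i,j,k)\mapsto(i,k)$; the identity of $I$ is $\Delta_I^!\,t_I^*\mathbb 1$, with $t_I:I\to 1$ and $\Delta_I:I\to I\times I$. The pseudofunctor $\mathrm{MatMult}_{\mathcal C}:\mathbf{Mat}_{\mathcal I}(\mathcal M)^{\mathrm{op}}\to\mathbf{Cat}$ sends $I$ to $\mathcal C_I$ and $M:I\to J$ to $\pi_I^!(M\bullet\pi_J^*(-)):\mathcal C_J\to\mathcal C_I$, where $\pi_I,\pi_J$ are the projections of $I\times J$; similarly for $\mathcal D$. **Copara and Para.** $\mathbf{Copara}_{\mathcal M}(\mathcal C)=\int\mathrm{MatMult}_{\mathcal C}$ is the bicategory with objects $(I,C)$, $C\in\mathcal C_I$; its 1-cells $(I,C)\to(J,C')$ are pairs $(M,f)$ with $M\in\mathcal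 M_{I\times J}$ and $f:C\to\pi_I^!(M\bullet\pi_J^*C')$; its 2-cells $(M,f)\to(N,f')$ are the morphisms $\alpha:M\to N$ of $\mathcal M_{I\times J}$ with $\pi_I^!(\alpha\bullet\pi_J^*C')\circ f=f'$. $\mathbf{Para}_{\mathcal M}(\mathcal D)^{\mathrm{op}}=\int\mathrm{MatMult}_{\mathcal D}(-)^{\mathrm{op}}$ is the bicategory with objects $(I,D)$, $D\in\mathcal D_I$; its 1-cells $(I,D)\to(J,D')$ are pairs $(M,g)$ with $g:\pi_I^!(M\bullet\pi_J^*D')\to D$; its 2-cells $(M,g)\to(N,g')$ are the $\alpha:M\to N$ with $g'\circ\pi_I^!(\alpha\bullet\pi_J^*D')=g$. Both project to $\mathbf{Mat}_{\mathcal I}(\mathcal M)$ by remembering $I$, $M$ and $\alpha$ (here a 1-cell $(I,-)\to(J,-)$ lies over an $M:I\to J$). **Fibre optics.** The category $\mathbf{FibOptic}^{\mathcal I}_{\mathcal M}(\mathcal C,\mathcal D)$ has as objects the triples $(I,C,D)$ with $I\in\mathcal I$, $C\in\mathcal C_I$, $D\in\mathcal D_I$, and as morphisms $(I,C,D)\to(J,C',D')$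 the elements $[M,f,g]$ of the set $$\int^{M\in\mathcal M_{I\times J}}\mathcal C_I\bigl(C,\pi_I^!(M\bullet\pi_J^*C')\bigr)\times\mathcal D_I\bigl(\pi_I^!(M\bullet\pi_J^*D'),D\bigr),$$ composed by composing matrices and using functoriality of matrix-vector multiplication and its associativity isomorphisms. Let $\mathbf{FibOptic}_2$ be the bicategory that remembers residuals: its objects are the same triples, its 1-cells are the triples $(M,f,g)$, and its 2-cells $(M,f,g)\to(N,f',g')$ are the $\alpha:M\to N$ that are 2-cells both of $\mathbf{Copara}_{\mathcal M}(\mathcal C)$ and of $\mathbf{Para}_{\mathcal M}(\mathcal D)^{\mathrm{op}}$. **Statement.** 1. The square formed by the evident projections of $\mathbf{FibOptic}_2$ to $\mathbf{Copara}_{\mathcal M}(\mathcal C)$ and to $\mathbf{Para}_{\mathcal M}(\mathcal D)^{\mathrm{op}}$, and by the projections of these to $\mathbf{Mat}_{\mathcal I}(\mathcal M)$, is a strict pullback: it commutes, and for every bicategory $\mathcal X$, any two pseudofunctors $U:\mathcal X\to\mathbf{Copara}_{\mathcal M}(\mathcal C)$ and $V:\mathcal X\to\mathbf{Para}_{\mathcal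 M}(\mathcal D)^{\mathrm{op}}$ with equal composites to $\mathbf{Mat}_{\mathcal I}(\mathcal M)$ are induced by a unique pseudofunctor $\mathcal X\to\mathbf{FibOptic}_2$. 2. The category $\mathbf{FibOptic}^{\mathcal I}_{\mathcal M}(\mathcal C,\mathcal D)$ is the local quotient of this pullback by connected components: the functor that is the identity on objects and sends $[M,f,g]$ to the connected component of $(M,f,g)$ is an isomorphism from $\mathbf{FibOptic}^{\mathcal I}_{\mathcal M}(\mathcal C,\mathcal D)$ to the category obtained from $\mathbf{FibOptic}_2$ by replacing each category of 1-cells with its set of connected components. Moreover, the hom-sets of $\mathbf{FibOptic}^{\mathcal I}_{\mathcal M}(\mathcal C,\mathcal D)$, with the maps $(f,g)\mapsto[M,f,g]$, have the universal property of the coend above. -/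

import Mathlib

open CategoryTheory MonoidalCategory CartesianMonoidalCategory MonoidalLeftAction

set_option linter.unusedSectionVars false

universe v₀ u₀ v₁ u₁ v₂ u₂ v₃ u₃

namespace FibreOptics

section Fibrations

variable {ℐ : Type u₀} [Category.{v₀} ℐ] {𝓔 : Type u₁} [Category.{v₁} 𝓔]

/-- `φ` is a cartesian arrow for `p` (over its own image). -/
abbrev IsCart (p : 𝓔 ⥤ ℐ) {a b : 𝓔} (φ : a ⟶ b) : Prop :=
  p.IsStronglyCartesian (p.map φ) φ

/-- `φ` is an opcartesian arrow for `p` (over its own image). -/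
abbrev IsOpcart (p : 𝓔 ⥤ ℐ) {a b : 𝓔} (φ : a ⟶ b) : Prop :=
  p.IsStronglyCocartesian (p.map φ) φ

/-- A bifibration: a functor that is both a fibration and an opfibration. -/
class Bifibration (p : 𝓔 ⥤ ℐ) : Prop extends p.IsFibered where
  exists_opcart {a : 𝓔} {S : ℐ} (f : p.obj a ⟶ S) :
    ∃ (b : 𝓔) (φ : a ⟶ b), p.IsStronglyCocartesian f φ

/-- The Beck–Chevalley condition for all pullback squares of the base: in a commutative square
lying over a pullback square in which two opposite sides `l`, `r` are cartesian, if `b` is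
opcartesian then so is the opposite side `t`. -/
class BeckChevalley (p : 𝓔 ⥤ ℐ) : Prop where
  opcart_of_isPullback {W X Z Y : 𝓔} (t : W ⟶ X) (l : W ⟶ Z) (r : X ⟶ Y) (b : Z ⟶ Y) :
    t ≫ r = l ≫ b → IsPullback (p.map t) (p.map l) (p.map r) (p.map b) →
    IsCart p l → IsCart p r → IsOpcart p b → IsOpcart p t

/-- A monoidal bifibration over a cartesian monoidal base: a bifibration that is a strict monoidal
functor and whose tensor product preserves cartesian and opcartesian arrows. -/
class MonoidalBifibration [CartesianMonoidalCategory ℐ] [MonoidalCategory 𝓔] (p : 𝓔 ⥤ ℐ) : Prop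
    extends Bifibration p where
  obj_unit : p.obj (𝟙_ 𝓔) = 𝟙_ ℐ
  obj_tensor (X Y : 𝓔) : p.obj (X ⊗ Y) = p.obj X ⊗ p.obj Y
  tensorHom_isHomLift {X X' Y Y' : 𝓔} (f : X ⟶ X') (g : Y ⟶ Y') :
    p.IsHomLift (p.map f ⊗ₘ p.map g) (f ⊗ₘ g)
  associator_isHomLift (X Y Z : 𝓔) :
    p.IsHomLift (α_ (p.obj X) (p.obj Y) (p.obj Z)).hom (α_ X Y Z).hom
  leftUnitor_isHomLift (X : 𝓔) : p.IsHomLift (λ_ (p.obj X)).hom (λ_ X).hom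
  rightUnitor_isHomLift (X : 𝓔) : p.IsHomLift (ρ_ (p.obj X)).hom (ρ_ X).hom
  tensor_isCart {X X' Y Y' : 𝓔} (f : X ⟶ X') (g : Y ⟶ Y') :
    IsCart p f → IsCart p g → IsCart p (f ⊗ₘ g)
  tensor_isOpcart {X X' Y Y' : 𝓔} (f : X ⟶ X') (g : Y ⟶ Y') :
    IsOpcart p f → IsOpcart p g → IsOpcart p (f ⊗ₘ g)

/-- A fibraction of a monoidal bifibration `pM : 𝓜 ⥤ ℐ` on a bifibration `p : 𝓔 ⥤ ℐ`: a (left)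
action of `𝓜` on `𝓔` lying strictly over the cartesian product of `ℐ` and preserving cartesian and
opcartesian arrows. -/
class Fibraction [CartesianMonoidalCategory ℐ] {𝓜 : Type u₂} [Category.{v₂} 𝓜]
    [MonoidalCategory 𝓜] [MonoidalLeftAction 𝓜 𝓔] (pM : 𝓜 ⥤ ℐ) (p : 𝓔 ⥤ ℐ) : Prop where
  obj_act (M : 𝓜) (X : 𝓔) : p.obj (M ⊙ₗ X) = pM.obj M ⊗ p.obj X
  actHom_isHomLift {M M' : 𝓜} {X X' : 𝓔} (f : M ⟶ M') (g : X ⟶ X') :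
    p.IsHomLift (pM.map f ⊗ₘ p.map g) (f ⊙ₗₘ g)
  assoc_isHomLift (M N : 𝓜) (X : 𝓔) :
    p.IsHomLift (α_ (pM.obj M) (pM.obj N) (p.obj X)).hom (αₗ M N X).hom
  unit_isHomLift (X : 𝓔) : p.IsHomLift (λ_ (p.obj X)).hom (λₗ[𝓜] X).hom
  act_isCart {M M' : 𝓜} {X X' : 𝓔} (f : M ⟶ M') (g : X ⟶ X') :
    IsCart pM f → IsCart p g → IsCart p (f ⊙ₗₘ g)
  act_isOpcart {M M' : 𝓜} {X X' : 𝓔} (f : M ⟶ M') (g : X ⟶ X') :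
    IsOpcart pM f → IsOpcart p g → IsOpcart p (f ⊙ₗₘ g)

/-- The tensor product of a monoidal bifibration is a fibraction on itself. -/
instance selfFibraction [CartesianMonoidalCategory ℐ] [MonoidalCategory 𝓔] (p : 𝓔 ⥤ ℐ)
    [h : MonoidalBifibration p] : Fibraction p p where
  obj_act := h.obj_tensor
  actHom_isHomLift := h.tensorHom_isHomLift
  assoc_isHomLift := h.associator_isHomLift
  unit_isHomLift := h.leftUnitor_isHomLift
  act_isCart := h.tensor_isCart
  act_isOpcart := h.tensor_isOpcart

variable {p : 𝓔 ⥤ ℐ}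

lemma isHomLift_of {a b : 𝓔} {R S : ℐ} (φ : a ⟶ b) (ha : p.obj a = R) (hb : p.obj b = S) :
    p.IsHomLift (eqToHom ha.symm ≫ p.map φ ≫ eqToHom hb) φ := by
  subst ha hb; simp

lemma map_eq_iff {a b : 𝓔} {φ ψ : a ⟶ b} {R S : ℐ} {f g : R ⟶ S} (h : p.IsHomLift f φ)
    (h' : p.IsHomLift g ψ) : p.map φ = p.map ψ ↔ f = g := by
  cases h; rw [IsHomLift.eq_of_isHomLift p g ψ]

lemma isCart_of {a b : 𝓔} {R S : ℐ} {f : R ⟶ S} {φ : a ⟶ b} (h : p.IsStronglyCartesian f φ) :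
    IsCart p φ := by
  obtain ⟨⟩ := (inferInstance : p.IsHomLift f φ); exact h

lemma isOpcart_of {a b : 𝓔} {R S : ℐ} {f : R ⟶ S} {φ : a ⟶ b}
    (h : p.IsStronglyCocartesian f φ) : IsOpcart p φ := by
  obtain ⟨⟩ := (inferInstance : p.IsHomLift f φ); exact h

lemma isCart_over {a b : 𝓔} {R S : ℐ} {f : R ⟶ S} {φ : a ⟶ b} (h : IsCart p φ)
    (hf : p.IsHomLift f φ) : p.IsStronglyCartesian f φ := by
  cases hf; exact h

lemma isOpcart_over {a b : 𝓔} {R S : ℐ} {f : R ⟶ S} {φ : a ⟶ b} (h : IsOpcart p φ)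
    (hf : p.IsHomLift f φ) : p.IsStronglyCocartesian f φ := by
  cases hf; exact h

lemma IsCart.lift {a b c : 𝓔} {φ : a ⟶ b} (h : IsCart p φ) {R S T : ℐ} {f : S ⟶ T}
    (hf : p.IsHomLift f φ) {ψ : c ⟶ b} {g : R ⟶ T} (hg : p.IsHomLift g ψ) (s : R ⟶ S)
    (e : s ≫ f = g) : ∃ l : c ⟶ a, p.IsHomLift s l ∧ l ≫ φ = ψ := by
  have := isCart_over h hf
  obtain ⟨l, hl, -⟩ := Functor.IsStronglyCartesian.universal_property p f φ s g e.symm ψ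
  exact ⟨l, hl⟩

lemma IsOpcart.desc {a b c : 𝓔} {φ : a ⟶ b} (h : IsOpcart p φ) {R S T : ℐ} {f : R ⟶ S}
    (hf : p.IsHomLift f φ) {ψ : a ⟶ c} {g : R ⟶ T} (hg : p.IsHomLift g ψ) (s : S ⟶ T)
    (e : f ≫ s = g) : ∃ l : b ⟶ c, p.IsHomLift s l ∧ φ ≫ l = ψ := by
  have := isOpcart_over h hf
  obtain ⟨l, hl, -⟩ := Functor.IsStronglyCocartesian.universal_property p f φ s g e.symm ψ
  exact ⟨l, hl⟩

lemma IsCart.ext {a b c : 𝓔} {φ : a ⟶ b} (h : IsCart p φ) {l l' : c ⟶ a}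
    (hp : p.map l = p.map l') (e : l ≫ φ = l' ≫ φ) : l = l' := by
  have : p.IsHomLift (p.map l) l' := hp ▸ inferInstance
  exact Functor.IsStronglyCartesian.ext p (p.map φ) φ (p.map l) e

lemma IsOpcart.ext {a b c : 𝓔} {φ : a ⟶ b} (h : IsOpcart p φ) {l l' : b ⟶ c}
    (hp : p.map l = p.map l') (e : φ ≫ l = φ ≫ l') : l = l' := by
  have : p.IsHomLift (p.map l) l' := hp ▸ inferInstance
  exact Functor.IsStronglyCocartesian.ext p (p.map φ) φ (p.map l) e

lemma IsCart.comp {a b c : 𝓔} {φ : a ⟶ b} {ψ : b ⟶ c} (h : IsCart p φ) (h' : IsCart p ψ) :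
    IsCart p (φ ≫ ψ) := by
  have : p.IsStronglyCartesian (p.map φ ≫ p.map ψ) (φ ≫ ψ) := inferInstance
  exact isCart_of this

lemma IsCart.of_comp {a b c : 𝓔} {φ : a ⟶ b} {ψ : b ⟶ c} (h : IsCart p ψ)
    (h' : IsCart p (φ ≫ ψ)) : IsCart p φ := by
  have : p.IsStronglyCartesian (p.map φ ≫ p.map ψ) (φ ≫ ψ) := by
    rw [← p.map_comp]; exact h'
  exact Functor.IsStronglyCartesian.of_comp p (g := p.map ψ) (ψ := ψ)

lemma IsOpcart.comp {a b c : 𝓔} {φ : a ⟶ b} {ψ : b ⟶ c} (h : IsOpcart p φ)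
    (h' : IsOpcart p ψ) : IsOpcart p (φ ≫ ψ) := by
  have : p.IsStronglyCocartesian (p.map φ ≫ p.map ψ) (φ ≫ ψ) := inferInstance
  exact isOpcart_of this

lemma IsCart.of_isIso {a b : 𝓔} (φ : a ⟶ b) [IsIso φ] : IsCart p φ := inferInstance

lemma IsOpcart.of_isIso {a b : 𝓔} (φ : a ⟶ b) [IsIso φ] : IsOpcart p φ := inferInstance

lemma IsCart.mono {a b : 𝓔} {φ : a ⟶ b} (h : IsCart p φ) (hm : Mono (p.map φ)) : Mono φ where
  right_cancellation l l' e := h.ext (by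
    rw [← cancel_mono (p.map φ), ← p.map_comp, ← p.map_comp, e]) e

/-- A commutative square with two opposite cartesian sides lying over a pullback square is a
pullback square. -/
lemma isPullback_of_isCart {W X Z Y : 𝓔} {t : W ⟶ X} {l : W ⟶ Z} {r : X ⟶ Y} {b : Z ⟶ Y}
    (e : t ≫ r = l ≫ b) (hp : IsPullback (p.map t) (p.map l) (p.map r) (p.map b))
    (hl : IsCart p l) (hr : IsCart p r) : IsPullback t l r b := by
  refine ⟨⟨e⟩, ⟨Limits.PullbackCone.IsLimit.mk _
    (fun s => ?_) (fun s => ?_) (fun s => ?_) (fun s m hm hm' => ?_)⟩⟩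
  all_goals
    have hs : p.map s.fst ≫ p.map r = p.map s.snd ≫ p.map b := by
      rw [← p.map_comp, ← p.map_comp, s.condition]
    have key : ∃ m : s.pt ⟶ W, p.IsHomLift (hp.lift _ _ hs) m ∧ m ≫ l = s.snd :=
      hl.lift inferInstance inferInstance _ (hp.lift_snd _ _ hs)
  · exact key.choose
  · have := key.choose_spec.1
    refine hr.ext ?_ ?_
    · rw [p.map_comp, ← IsHomLift.eq_of_isHomLift p (hp.lift _ _ hs) key.choose, hp.lift_fst]
    · rw [Category.assoc, e, reassoc_of% key.choose_spec.2, s.condition]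
  · exact key.choose_spec.2
  · have := key.choose_spec.1
    refine hl.ext ?_ (hm'.trans key.choose_spec.2.symm)
    rw [← IsHomLift.eq_of_isHomLift p (hp.lift _ _ hs) key.choose]
    refine hp.hom_ext ?_ ?_
    · rw [hp.lift_fst, ← p.map_comp, hm]
    · rw [hp.lift_snd, ← p.map_comp, hm']

lemma exists_isCart [p.IsFibered] {a : 𝓔} {R S : ℐ} (f : R ⟶ S) (ha : p.obj a = S) :
    ∃ (b : 𝓔) (φ : b ⟶ a), p.IsStronglyCartesian f φ := by
  obtain ⟨b, φ, h⟩ := IsPreFibered.exists_isCartesian p ha f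
  exact ⟨b, φ, inferInstance⟩

end Fibrations

section Spans

variable {ℐ : Type u₀} [Category.{v₀} ℐ] {𝓔 : Type u₁} [Category.{v₁} 𝓔] (p : 𝓔 ⥤ ℐ)

/-- A span in the total category whose left leg is cartesian and whose right leg is opcartesian. -/
structure PSpan (E F : 𝓔) where
  Z : 𝓔
  c : Z ⟶ E
  b : Z ⟶ F
  cart : IsCart p c
  opcart : IsOpcart p b

namespace PSpan

variable {p} {E F G H E' F' G' E'' F'' : 𝓔}

/-- A square between spans with vertical sides `f` and `g`. -/
def Sq (σ : PSpan p E F) (σ' : PSpan p E' F') (f : E ⟶ E') (g : F ⟶ F') : Prop :=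
  ∃ θ : σ.Z ⟶ σ'.Z, θ ≫ σ'.c = σ.c ≫ f ∧ θ ≫ σ'.b = σ.b ≫ g

/-- The identity span. -/
abbrev id (E : 𝓔) : PSpan p E E := ⟨E, 𝟙 E, 𝟙 E, inferInstance, inferInstance⟩

lemma Sq.refl (σ : PSpan p E F) : Sq σ σ (𝟙 _) (𝟙 _) := ⟨𝟙 _, by simp, by simp⟩

lemma Sq.idSq (f : E ⟶ E') : Sq (id E : PSpan p E E) (id E') f f :=
  ⟨f, (Category.comp_id f).trans (Category.id_comp f).symm,
    (Category.comp_id f).trans (Category.id_comp f).symm⟩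

lemma Sq.trans {σ : PSpan p E F} {σ' : PSpan p E' F'} {σ'' : PSpan p E'' F''}
    {f : E ⟶ E'} {g : F ⟶ F'} {f' : E' ⟶ E''} {g' : F' ⟶ F''}
    (h : Sq σ σ' f g) (h' : Sq σ' σ'' f' g') : Sq σ σ'' (f ≫ f') (g ≫ g') := by
  obtain ⟨θ, h₁, h₂⟩ := h
  obtain ⟨θ', h₁', h₂'⟩ := h'
  exact ⟨θ ≫ θ', by rw [Category.assoc, h₁', reassoc_of% h₁],
    by rw [Category.assoc, h₂', reassoc_of% h₂]⟩

lemma Sq.post {σ : PSpan p E F} {σ' : PSpan p E' F'} {σ'' : PSpan p E' F'}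
    {f : E ⟶ E'} {g : F ⟶ F'} (h : Sq σ σ' f g) (h' : Sq σ' σ'' (𝟙 _) (𝟙 _)) : Sq σ σ'' f g := by
  simpa using h.trans h'

lemma Sq.pre {σ : PSpan p E F} {σ' : PSpan p E F} {σ'' : PSpan p E' F'}
    {f : E ⟶ E'} {g : F ⟶ F'} (h : Sq σ σ' (𝟙 _) (𝟙 _)) (h' : Sq σ' σ'' f g) : Sq σ σ'' f g := by
  simpa using h.trans h'

lemma Sq.uniq {σ : PSpan p E F} {σ' : PSpan p E' F'} {f : E ⟶ E'} {g g' : F ⟶ F'}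
    (h : Sq σ σ' f g) (h' : Sq σ σ' f g') (hm : Mono σ'.c) (e : p.map g = p.map g') : g = g' := by
  obtain ⟨θ, h₁, h₂⟩ := h
  obtain ⟨θ', h₁', h₂'⟩ := h'
  obtain rfl : θ = θ' := by rw [← cancel_mono σ'.c, h₁, h₁']
  exact σ.opcart.ext e (h₂.symm.trans h₂')

/-- Two spans over the same span of the base are canonically isomorphic. -/
lemma exists_iso (σ : PSpan p E F) (σ' : PSpan p E' F') (f : E ≅ E') {S A A' B : ℐ} {s : S ⟶ A}
    {s' : S ⟶ A'} {t : S ⟶ B} {a : A ⟶ A'} (ha : p.IsHomLift a f.hom)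
    (hs : p.IsHomLift s σ.c) (hs' : p.IsHomLift s' σ'.c) (e : s ≫ a = s')
    (ht : p.IsHomLift t σ.b) (ht' : p.IsHomLift t σ'.b) :
    ∃ g : F ≅ F', p.IsHomLift (𝟙 B) g.hom ∧ Sq σ σ' f.hom g.hom ∧ Sq σ' σ f.inv g.inv := by
  have ha' : IsCart p (σ.c ≫ f.hom) := σ.cart.comp (IsCart.of_isIso _)
  have hsa : p.IsHomLift s' (σ.c ≫ f.hom) := e ▸ inferInstance
  obtain ⟨θ, hθ, eθ⟩ := σ'.cart.lift hs' hsa (𝟙 S) (Category.id_comp _)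
  obtain ⟨θ', hθ', eθ'⟩ := ha'.lift hsa hs' (𝟙 S) (Category.id_comp _)
  obtain ⟨g, hg, eg⟩ := σ.opcart.desc ht (ψ := θ ≫ σ'.b) (g := 𝟙 S ≫ t) inferInstance (𝟙 B)
    (by simp)
  obtain ⟨g', hg', eg'⟩ := σ'.opcart.desc ht' (ψ := θ' ≫ σ.b) (g := 𝟙 S ≫ t) inferInstance (𝟙 B)
    (by simp)
  have hZ : p.IsHomLift (𝟙 S) (𝟙 σ.Z) := IsHomLift.id (IsHomLift.domain_eq p s σ.c)
  have hZ' : p.IsHomLift (𝟙 S) (𝟙 σ'.Z) := IsHomLift.id (IsHomLift.domain_eq p s' σ'.c)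
  have hF : p.IsHomLift (𝟙 B) (𝟙 F) := IsHomLift.id (IsHomLift.codomain_eq p t σ.b)
  have hF' : p.IsHomLift (𝟙 B) (𝟙 F') := IsHomLift.id (IsHomLift.codomain_eq p t σ'.b)
  have e₁ : θ ≫ θ' = 𝟙 _ := ha'.ext
    ((map_eq_iff (f := 𝟙 S) (g := 𝟙 S) inferInstance inferInstance).2 rfl) (by simp [eθ, eθ'])
  have e₂ : θ' ≫ θ = 𝟙 _ := σ'.cart.ext
    ((map_eq_iff (f := 𝟙 S) (g := 𝟙 S) inferInstance inferInstance).2 rfl) (by simp [eθ, eθ'])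
  refine ⟨⟨g, g', σ.opcart.ext ((map_eq_iff (f := 𝟙 B) (g := 𝟙 B) inferInstance inferInstance).2
      rfl) ?_, σ'.opcart.ext ((map_eq_iff (f := 𝟙 B) (g := 𝟙 B) inferInstance inferInstance).2
      rfl) ?_⟩, hg, ⟨θ, eθ, eg.symm⟩, ⟨θ', ?_, eg'.symm⟩⟩
  · rw [reassoc_of% eg, eg', reassoc_of% e₁, Category.comp_id]
  · rw [reassoc_of% eg', eg, reassoc_of% e₂, Category.comp_id]
  · rw [Iso.eq_comp_inv, Category.assoc, eθ']

section comp

variable [p.IsFibered] [BeckChevalley p]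

lemma exists_comp (σ : PSpan p E F) (τ : PSpan p F G) {S T Q A B C : ℐ}
    {s : S ⟶ A} {t : S ⟶ B} {s' : T ⟶ B} {t' : T ⟶ C} {g : Q ⟶ S} {h : Q ⟶ T}
    (hs : p.IsHomLift s σ.c) (ht : p.IsHomLift t σ.b) (hs' : p.IsHomLift s' τ.c)
    (ht' : p.IsHomLift t' τ.b) (hQ : IsPullback g h t s') :
    ∃ (ρ : PSpan p E G) (x : ρ.Z ⟶ σ.Z) (y : ρ.Z ⟶ τ.Z), p.IsHomLift (g ≫ s) ρ.c ∧
      p.IsHomLift (h ≫ t') ρ.b ∧ IsPullback x y σ.b τ.c ∧ x ≫ σ.c = ρ.c ∧ y ≫ τ.b = ρ.b ∧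
      IsPullback (p.map x) (p.map y) (p.map σ.b) (p.map τ.c) := by
  obtain ⟨W, x, hx⟩ := exists_isCart (p := p) g (IsHomLift.domain_eq p s σ.c)
  obtain ⟨y, hy, e⟩ := τ.cart.lift hs' (ψ := x ≫ σ.b) (g := g ≫ t) inferInstance h hQ.w.symm
  have hsq : IsPullback (p.map y) (p.map x) (p.map τ.c) (p.map σ.b) := by
    have hx' : p.IsHomLift g x := inferInstance
    clear e hs ht'
    obtain rfl : p.obj σ.Z = S := IsHomLift.domain_eq p t σ.b
    obtain rfl : p.obj F = B := IsHomLift.codomain_eq p t σ.b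
    obtain rfl : p.obj τ.Z = T := IsHomLift.domain_eq p s' τ.c
    obtain rfl : p.obj W = Q := IsHomLift.domain_eq p g x
    rw [← IsHomLift.eq_of_isHomLift p g x, ← IsHomLift.eq_of_isHomLift p t σ.b,
      ← IsHomLift.eq_of_isHomLift p h y, ← IsHomLift.eq_of_isHomLift p s' τ.c]
    exact hQ.flip
  have hy' := BeckChevalley.opcart_of_isPullback y x τ.c σ.b e hsq (isCart_of hx) τ.cart σ.opcart
  exact ⟨⟨W, x ≫ σ.c, y ≫ τ.b, (isCart_of hx).comp σ.cart, hy'.comp τ.opcart⟩, x, y,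
    inferInstance, inferInstance,
    (isPullback_of_isCart e hsq (isCart_of hx) τ.cart).flip, rfl, rfl, hsq.flip⟩

variable [Limits.HasPullbacks ℐ]

lemma exists_comp' (σ : PSpan p E F) (τ : PSpan p F G) :
    ∃ (ρ : PSpan p E G) (x : ρ.Z ⟶ σ.Z) (y : ρ.Z ⟶ τ.Z),
      IsPullback x y σ.b τ.c ∧ x ≫ σ.c = ρ.c ∧ y ≫ τ.b = ρ.b ∧
      IsPullback (p.map x) (p.map y) (p.map σ.b) (p.map τ.c) := by
  obtain ⟨ρ, x, y, -, -, h⟩ := exists_comp σ τ (IsHomLift.map p σ.c) (IsHomLift.map p σ.b)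
    (IsHomLift.map p τ.c) (IsHomLift.map p τ.b) (IsPullback.of_hasPullback (p.map σ.b) (p.map τ.c))
  exact ⟨ρ, x, y, h⟩

/-- A composite of two spans. -/
noncomputable def comp (σ : PSpan p E F) (τ : PSpan p F G) : PSpan p E G :=
  (exists_comp' σ τ).choose

noncomputable def compFst (σ : PSpan p E F) (τ : PSpan p F G) : (σ.comp τ).Z ⟶ σ.Z :=
  (exists_comp' σ τ).choose_spec.choose

noncomputable def compSnd (σ : PSpan p E F) (τ : PSpan p F G) : (σ.comp τ).Z ⟶ τ.Z :=
  (exists_comp' σ τ).choose_spec.choose_spec.choose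

lemma comp_isPullback (σ : PSpan p E F) (τ : PSpan p F G) :
    IsPullback (compFst σ τ) (compSnd σ τ) σ.b τ.c :=
  (exists_comp' σ τ).choose_spec.choose_spec.choose_spec.1

lemma compFst_c (σ : PSpan p E F) (τ : PSpan p F G) : compFst σ τ ≫ σ.c = (σ.comp τ).c :=
  (exists_comp' σ τ).choose_spec.choose_spec.choose_spec.2.1

lemma compSnd_b (σ : PSpan p E F) (τ : PSpan p F G) : compSnd σ τ ≫ τ.b = (σ.comp τ).b :=
  (exists_comp' σ τ).choose_spec.choose_spec.choose_spec.2.2.1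

lemma comp_base_isPullback (σ : PSpan p E F) (τ : PSpan p F G) :
    IsPullback (p.map (compFst σ τ)) (p.map (compSnd σ τ)) (p.map σ.b) (p.map τ.c) :=
  (exists_comp' σ τ).choose_spec.choose_spec.choose_spec.2.2.2

lemma compFst_isCart (σ : PSpan p E F) (τ : PSpan p F G) : IsCart p (compFst σ τ) :=
  IsCart.of_comp σ.cart (by rw [compFst_c]; exact (σ.comp τ).cart)

lemma comp_w (σ : PSpan p E F) (τ : PSpan p F G) : compFst σ τ ≫ σ.b = compSnd σ τ ≫ τ.c :=
  (comp_isPullback σ τ).w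

lemma Sq.mk_comp {σ : PSpan p E F} {τ : PSpan p F G} {ρ : PSpan p E' G'} {f : E' ⟶ E}
    {g : G' ⟶ G} (x : ρ.Z ⟶ σ.Z) (y : ρ.Z ⟶ τ.Z) (w : x ≫ σ.b = y ≫ τ.c)
    (hx : x ≫ σ.c = ρ.c ≫ f) (hy : y ≫ τ.b = ρ.b ≫ g) : Sq ρ (σ.comp τ) f g :=
  ⟨(comp_isPullback σ τ).lift x y w,
    by rw [← compFst_c, (comp_isPullback σ τ).lift_fst_assoc, hx],
    by rw [← compSnd_b, (comp_isPullback σ τ).lift_snd_assoc, hy]⟩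

lemma Sq.hcomp {σ : PSpan p E F} {σ' : PSpan p E' F'} {τ : PSpan p F G} {τ' : PSpan p F' G'}
    {f : E ⟶ E'} {g : F ⟶ F'} {h : G ⟶ G'} (H : Sq σ σ' f g) (K : Sq τ τ' g h) :
    Sq (σ.comp τ) (σ'.comp τ') f h := by
  obtain ⟨θ, h₁, h₂⟩ := H
  obtain ⟨φ, k₁, k₂⟩ := K
  refine Sq.mk_comp (compFst σ τ ≫ θ) (compSnd σ τ ≫ φ) ?_ ?_ ?_
  · rw [Category.assoc, h₂, Category.assoc, k₁, ← Category.assoc, comp_w, Category.assoc]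
  · rw [Category.assoc, h₁, ← compFst_c, Category.assoc]
  · rw [Category.assoc, k₂, ← compSnd_b, Category.assoc]

lemma id_comp (σ : PSpan p E F) : Sq ((id E).comp σ) σ (𝟙 _) (𝟙 _) :=
  ⟨compSnd _ _, by
    rw [← comp_w, ← compFst_c, Category.comp_id]; exact (Category.comp_id _).symm,
    by rw [← compSnd_b, Category.comp_id]⟩

lemma id_comp' (σ : PSpan p E F) : Sq σ ((id E).comp σ) (𝟙 _) (𝟙 _) :=
  Sq.mk_comp σ.c (𝟙 _) ((Category.comp_id _).trans (Category.id_comp _).symm) rfl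
    ((Category.id_comp _).trans (Category.comp_id _).symm)

lemma comp_id (σ : PSpan p E F) : Sq (σ.comp (id F)) σ (𝟙 _) (𝟙 _) :=
  ⟨compFst _ _, by rw [← compFst_c, Category.comp_id],
    by
    rw [comp_w, ← compSnd_b, Category.comp_id]; exact (Category.comp_id _).symm⟩

lemma comp_id' (σ : PSpan p E F) : Sq σ (σ.comp (id F)) (𝟙 _) (𝟙 _) :=
  Sq.mk_comp (𝟙 _) σ.b ((Category.id_comp _).trans (Category.comp_id _).symm)
    ((Category.id_comp _).trans (Category.comp_id _).symm) rfl

lemma mono_comp {σ : PSpan p E F} {τ : PSpan p F G} (h : Mono (p.map σ.c))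
    (h' : Mono (p.map τ.c)) : Mono (p.map (σ.comp τ).c) := by
  have : Mono (p.map (compFst σ τ)) := (comp_base_isPullback σ τ).mono_fst_of_mono
  rw [← compFst_c, p.map_comp]
  infer_instance

lemma assoc (σ : PSpan p E F) (τ : PSpan p F G) (υ : PSpan p G H) :
    Sq ((σ.comp τ).comp υ) (σ.comp (τ.comp υ)) (𝟙 _) (𝟙 _) := by
  refine Sq.mk_comp (compFst _ _ ≫ compFst σ τ)
    ((comp_isPullback τ υ).lift (compFst _ _ ≫ compSnd σ τ) (compSnd _ _) ?_) ?_ ?_ ?_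
  · rw [Category.assoc, compSnd_b, comp_w]
  · rw [← compFst_c τ υ, (comp_isPullback τ υ).lift_fst_assoc, Category.assoc, Category.assoc,
      comp_w]
  · rw [Category.assoc, compFst_c, compFst_c, Category.comp_id]
  · rw [← compSnd_b τ υ, (comp_isPullback τ υ).lift_snd_assoc, compSnd_b, Category.comp_id]

lemma assoc' (σ : PSpan p E F) (τ : PSpan p F G) (υ : PSpan p G H) :
    Sq (σ.comp (τ.comp υ)) ((σ.comp τ).comp υ) (𝟙 _) (𝟙 _) := by
  refine Sq.mk_comp ((comp_isPullback σ τ).lift (compFst _ _) (compSnd _ _ ≫ compFst τ υ) ?_)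
    (compSnd _ _ ≫ compSnd τ υ) ?_ ?_ ?_
  · rw [Category.assoc, compFst_c, comp_w]
  · rw [← compSnd_b σ τ, (comp_isPullback σ τ).lift_snd_assoc, Category.assoc, Category.assoc,
      comp_w]
  · rw [← compFst_c σ τ, (comp_isPullback σ τ).lift_fst_assoc, compFst_c, Category.comp_id]
  · rw [Category.assoc, compSnd_b, compSnd_b, Category.comp_id]

lemma exists_typed_comp (σ : PSpan p E F) (τ : PSpan p F G) {S T Q A B C : ℐ}
    {s : S ⟶ A} {t : S ⟶ B} {s' : T ⟶ B} {t' : T ⟶ C} {g : Q ⟶ S} {h : Q ⟶ T}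
    (hs : p.IsHomLift s σ.c) (ht : p.IsHomLift t σ.b) (hs' : p.IsHomLift s' τ.c)
    (ht' : p.IsHomLift t' τ.b) (hQ : IsPullback g h t s') :
    ∃ ρ : PSpan p E G, p.IsHomLift (g ≫ s) ρ.c ∧ p.IsHomLift (h ≫ t') ρ.b ∧
      Sq ρ (σ.comp τ) (𝟙 _) (𝟙 _) ∧ Sq (σ.comp τ) ρ (𝟙 _) (𝟙 _) := by
  obtain ⟨ρ, x, y, h₁, h₂, hp, e₁, e₂, -⟩ := exists_comp σ τ hs ht hs' ht' hQ
  refine ⟨ρ, h₁, h₂, Sq.mk_comp x y hp.w (by simp [e₁]) (by simp [e₂]),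
    hp.lift (compFst _ _) (compSnd _ _) (comp_w _ _), ?_, ?_⟩
  · rw [← e₁, hp.lift_fst_assoc, compFst_c, Category.comp_id]
  · rw [← e₂, hp.lift_snd_assoc, compSnd_b, Category.comp_id]

end comp

end PSpan

end Spans

section Action

variable {ℐ : Type u₀} [Category.{v₀} ℐ] [CartesianMonoidalCategory ℐ]

lemma tensor_isPullback {P X Y Z P' X' Y' Z' : ℐ} {f : P ⟶ X} {g : P ⟶ Y} {h : X ⟶ Z} {k : Y ⟶ Z}
    {f' : P' ⟶ X'} {g' : P' ⟶ Y'} {h' : X' ⟶ Z'} {k' : Y' ⟶ Z'}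
    (H : IsPullback f g h k) (H' : IsPullback f' g' h' k') :
    IsPullback (f ⊗ₘ f') (g ⊗ₘ g') (h ⊗ₘ h') (k ⊗ₘ k') := by
  refine ⟨⟨by rw [tensorHom_comp_tensorHom, tensorHom_comp_tensorHom, H.w, H'.w]⟩,
    ⟨Limits.PullbackCone.IsLimit.mk _ (fun s => lift
      (H.lift (s.fst ≫ fst _ _) (s.snd ≫ fst _ _) ?_)
      (H'.lift (s.fst ≫ snd _ _) (s.snd ≫ snd _ _) ?_))
      (fun s => ?_) (fun s => ?_) (fun s m hm hm' => ?_)⟩⟩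
  · have := s.condition =≫ fst _ _
    simpa using this
  · have := s.condition =≫ snd _ _
    simpa using this
  · ext <;> simp
  · ext <;> simp
  · ext
    · apply H.hom_ext
      · simpa using hm =≫ fst _ _
      · simpa using hm' =≫ fst _ _
    · apply H'.hom_ext
      · simpa using hm =≫ snd _ _
      · simpa using hm' =≫ snd _ _

variable {𝓜 : Type u₁} [Category.{v₁} 𝓜] [MonoidalCategory 𝓜] {pM : 𝓜 ⥤ ℐ}
  {𝓔 : Type u₂} [Category.{v₂} 𝓔] [MonoidalLeftAction 𝓜 𝓔] {p : 𝓔 ⥤ ℐ}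

namespace PSpan

section

variable [Fibraction pM p] {A B C A' B' : 𝓜} {E F G E' F' : 𝓔}

/-- The action of spans on spans. -/
abbrev act (σ : PSpan pM A B) (τ : PSpan p E F) : PSpan p (A ⊙ₗ E) (B ⊙ₗ F) where
  Z := σ.Z ⊙ₗ τ.Z
  c := σ.c ⊙ₗₘ τ.c
  b := σ.b ⊙ₗₘ τ.b
  cart := Fibraction.act_isCart _ _ σ.cart τ.cart
  opcart := Fibraction.act_isOpcart _ _ σ.opcart τ.opcart

lemma Sq.act {σ : PSpan pM A B} {σ' : PSpan pM A' B'} {τ : PSpan p E F} {τ' : PSpan p E' F'}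
    {f : A ⟶ A'} {g : B ⟶ B'} {h : E ⟶ E'} {k : F ⟶ F'} (H : Sq σ σ' f g) (K : Sq τ τ' h k) :
    Sq (σ.act τ) (σ'.act τ') (f ⊙ₗₘ h) (g ⊙ₗₘ k) := by
  obtain ⟨θ, h₁, h₂⟩ := H
  obtain ⟨φ, k₁, k₂⟩ := K
  refine ⟨θ ⊙ₗₘ φ, ?_, ?_⟩
  · rw [← MonoidalLeftAction.actionHom_comp, ← MonoidalLeftAction.actionHom_comp,
      h₁, k₁]
  · rw [← MonoidalLeftAction.actionHom_comp, ← MonoidalLeftAction.actionHom_comp,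
      h₂, k₂]

lemma map_act_eq {M M' : 𝓜} {X X' : 𝓔} (f : M ⟶ M') (g : X ⟶ X') :
    p.map (f ⊙ₗₘ g) = eqToHom (Fibraction.obj_act (pM := pM) (p := p) M X) ≫ (pM.map f ⊗ₘ p.map g) ≫
      eqToHom (Fibraction.obj_act (pM := pM) (p := p) M' X').symm := by
  have : p.IsHomLift (pM.map f ⊗ₘ p.map g) (f ⊙ₗₘ g) := Fibraction.actHom_isHomLift f g
  exact IsHomLift.fac' p _ _

lemma mono_act {σ : PSpan pM A B} {τ : PSpan p E F} (h : Mono (pM.map σ.c))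
    (h' : Mono (p.map τ.c)) : Mono (p.map (σ.act τ).c) := by
  have : Mono (pM.map σ.c ⊗ₘ p.map τ.c) :=
    ⟨fun x y e => CartesianMonoidalCategory.hom_ext _ _
      ((cancel_mono (pM.map σ.c)).1 (by simpa using e =≫ fst _ _))
      ((cancel_mono (p.map τ.c)).1 (by simpa using e =≫ snd _ _))⟩
  change Mono (p.map (σ.c ⊙ₗₘ τ.c))
  rw [map_act_eq (pM := pM)]
  infer_instance

lemma mono_id (E : 𝓔) : Mono (p.map (id E : PSpan p E E).c) := by
  change Mono (p.map (𝟙 E))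
  infer_instance

lemma id_act_id (A : 𝓜) (E : 𝓔) : Sq ((id A : PSpan pM A A).act (id E : PSpan p E E))
    (id (A ⊙ₗ E)) (𝟙 _) (𝟙 _) :=
  ⟨𝟙 _, by simp, by simp⟩

lemma id_act_id' (A : 𝓜) (E : 𝓔) : Sq (id (A ⊙ₗ E))
    ((id A : PSpan pM A A).act (id E : PSpan p E E)) (𝟙 _) (𝟙 _) :=
  ⟨𝟙 _, by simp, by simp⟩

lemma id_unit_act (τ : PSpan p E F) : Sq ((id (𝟙_ 𝓜) : PSpan pM _ _).act τ) τ
    (λₗ[𝓜] E).hom (λₗ[𝓜] F).hom :=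
  ⟨(λₗ[𝓜] τ.Z).hom, by
    change _ = (𝟙 _ ⊙ₗₘ τ.c) ≫ _
    rw [MonoidalLeftAction.id_actionHom, MonoidalLeftAction.actionUnitIso_hom_naturality], by
    change _ = (𝟙 _ ⊙ₗₘ τ.b) ≫ _
    rw [MonoidalLeftAction.id_actionHom, MonoidalLeftAction.actionUnitIso_hom_naturality]⟩

variable [Limits.HasPullbacks ℐ] [pM.IsFibered] [p.IsFibered] [BeckChevalley pM] [BeckChevalley p]
  (σ : PSpan pM A B) (σ' : PSpan pM B C) (τ : PSpan p E F) (τ' : PSpan p F G)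

lemma comp_act_comp : Sq ((σ.comp σ').act (τ.comp τ')) ((σ.act τ).comp (σ'.act τ'))
    (𝟙 _) (𝟙 _) := by
  refine Sq.mk_comp (compFst σ σ' ⊙ₗₘ compFst τ τ') (compSnd σ σ' ⊙ₗₘ compSnd τ τ') ?_ ?_ ?_
  · rw [← MonoidalLeftAction.actionHom_comp, ← MonoidalLeftAction.actionHom_comp,
      comp_w, comp_w]
  · rw [← MonoidalLeftAction.actionHom_comp, compFst_c, compFst_c,
      Category.comp_id]
  · rw [← MonoidalLeftAction.actionHom_comp, compSnd_b, compSnd_b,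
      Category.comp_id]

lemma act_comp_act : Sq ((σ.act τ).comp (σ'.act τ')) ((σ.comp σ').act (τ.comp τ'))
    (𝟙 _) (𝟙 _) := by
  have hp : IsPullback (compSnd σ σ' ⊙ₗₘ compSnd τ τ') (compFst σ σ' ⊙ₗₘ compFst τ τ')
      (σ'.act τ').c (σ.act τ).b := by
    refine isPullback_of_isCart (p := p) ?_ ?_ ?_ (σ'.act τ').cart
    · rw [← MonoidalLeftAction.actionHom_comp,
        ← MonoidalLeftAction.actionHom_comp, comp_w, comp_w]
    · refine IsPullback.of_iso (tensor_isPullback (comp_base_isPullback σ σ')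
        (comp_base_isPullback τ τ')).flip (eqToIso (Fibraction.obj_act (pM := pM) (p := p) _ _).symm)
        (eqToIso (Fibraction.obj_act (pM := pM) (p := p) _ _).symm) (eqToIso (Fibraction.obj_act (pM := pM) (p := p) _ _).symm)
        (eqToIso (Fibraction.obj_act (pM := pM) (p := p) _ _).symm) ?_ ?_ ?_ ?_ <;>
      simp [map_act_eq (pM := pM) (p := p)]
    · exact Fibraction.act_isCart _ _ (compFst_isCart σ σ') (compFst_isCart τ τ')
  refine ⟨hp.flip.lift (compFst _ _) (compSnd _ _) (comp_w _ _), ?_, ?_⟩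
  · change _ ≫ ((σ.comp σ').c ⊙ₗₘ (τ.comp τ').c) = _
    rw [← compFst_c σ σ', ← compFst_c τ τ', MonoidalLeftAction.actionHom_comp,
      hp.flip.lift_fst_assoc, compFst_c, Category.comp_id]
  · change _ ≫ ((σ.comp σ').b ⊙ₗₘ (τ.comp τ').b) = _
    rw [← compSnd_b σ σ', ← compSnd_b τ τ', MonoidalLeftAction.actionHom_comp,
      hp.flip.lift_snd_assoc, compSnd_b, Category.comp_id]

/-- Interchange. -/
lemma act_interchange : Sq ((σ.act (id E)).comp ((id B : PSpan pM B B).act τ))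
    (((id A : PSpan pM A A).act τ).comp (σ.act (id F))) (𝟙 _) (𝟙 _) := by
  have h₁ := (act_comp_act σ (id B) (id E) τ).trans
    ((Sq.act ((comp_id σ).trans (id_comp' σ)) ((id_comp τ).trans (comp_id' τ))).trans
      (comp_act_comp (id A) σ τ (id F)))
  simpa using h₁

lemma act_interchange' : Sq (((id A : PSpan pM A A).act τ).comp (σ.act (id F)))
    ((σ.act (id E)).comp ((id B : PSpan pM B B).act τ)) (𝟙 _) (𝟙 _) := by
  have h₁ := (act_comp_act (id A) σ τ (id F)).trans
    ((Sq.act ((id_comp σ).trans (comp_id' σ)) ((comp_id τ).trans (id_comp' τ))).trans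
      (comp_act_comp σ (id B) (id E) τ))
  simpa using h₁

end

section

variable [MonoidalBifibration pM] {A B A' B' : 𝓜}

/-- The tensor product of spans. -/
abbrev tensor (σ : PSpan pM A B) (τ : PSpan pM A' B') : PSpan pM (A ⊗ A') (B ⊗ B') :=
  act (𝓜 := 𝓜) (𝓔 := 𝓜) (pM := pM) (p := pM) σ τ

variable [Fibraction pM p] {E F : 𝓔}

lemma act_assoc (σ : PSpan pM A B) (τ : PSpan pM A' B') (υ : PSpan p E F) :
    Sq ((σ.tensor τ).act υ) (σ.act (τ.act υ)) (αₗ _ _ _).hom (αₗ _ _ _).hom :=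
  ⟨(αₗ _ _ _).hom, (MonoidalLeftAction.actionAssocIso_hom_naturality _ _ _).symm,
    (MonoidalLeftAction.actionAssocIso_hom_naturality _ _ _).symm⟩

lemma act_assoc' (σ : PSpan pM A B) (τ : PSpan pM A' B') (υ : PSpan p E F) :
    Sq (σ.act (τ.act υ)) ((σ.tensor τ).act υ) (αₗ _ _ _).inv (αₗ _ _ _).inv :=
  ⟨(αₗ _ _ _).inv, (MonoidalLeftAction.actionAssocIso_inv_naturality _ _ _).symm,
    (MonoidalLeftAction.actionAssocIso_inv_naturality _ _ _).symm⟩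

end

end PSpan

end Action

section Matrices

variable {ℐ : Type u₀} [Category.{v₀} ℐ] [CartesianMonoidalCategory ℐ]

variable (ℐ) in
/-- A family of objects `A J ≅ J × K`, natural in `J`, for a fixed object `K`. -/
structure Frame where
  A : ℐ → ℐ
  K : ℐ
  r (J : ℐ) : A J ⟶ J
  k (J : ℐ) : A J ⟶ K
  pr {R J : ℐ} : (R ⟶ J) → (R ⟶ K) → (R ⟶ A J)
  pr_r {R J : ℐ} (x : R ⟶ J) (y : R ⟶ K) : pr x y ≫ r J = x
  pr_k {R J : ℐ} (x : R ⟶ J) (y : R ⟶ K) : pr x y ≫ k J = y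
  hom_ext {R J : ℐ} {x y : R ⟶ A J} : x ≫ r J = y ≫ r J → x ≫ k J = y ≫ k J → x = y

attribute [simp] Frame.pr_r Frame.pr_k

@[simp] lemma Frame.pr_r_assoc (𝔉 : Frame ℐ) {R J Z : ℐ} (x : R ⟶ J) (y : R ⟶ 𝔉.K) (z : J ⟶ Z) :
    𝔉.pr x y ≫ 𝔉.r J ≫ z = x ≫ z := by
  rw [← Category.assoc, 𝔉.pr_r]

@[simp] lemma Frame.pr_k_assoc (𝔉 : Frame ℐ) {R J Z : ℐ} (x : R ⟶ J) (y : R ⟶ 𝔉.K)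
    (z : 𝔉.K ⟶ Z) : 𝔉.pr x y ≫ 𝔉.k J ≫ z = y ≫ z := by
  rw [← Category.assoc, 𝔉.pr_k]

/-- The frame `J ↦ J`. -/
abbrev Frame.one : Frame ℐ where
  A J := J
  K := 𝟙_ ℐ
  r J := 𝟙 J
  k J := toUnit J
  pr x _ := x
  pr_r _ _ := Category.comp_id _
  pr_k _ _ := toUnit_unique _ _
  hom_ext h _ := by simpa using h

/-- The frame `J ↦ J ⊗ K`. -/
abbrev Frame.prod (K : ℐ) : Frame ℐ where
  A J := J ⊗ K
  K := K
  r J := fst J K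
  k J := snd J K
  pr x y := lift x y
  pr_r _ _ := lift_fst _ _
  pr_k _ _ := lift_snd _ _
  hom_ext h h' := CartesianMonoidalCategory.hom_ext _ _ h h'

namespace Frame

variable (𝔉 : Frame ℐ)

/-- `(i, j, k) ↦ ((i, j), (j, k))` -/
def d (I J : ℐ) : 𝔉.A (I ⊗ J) ⟶ (I ⊗ J) ⊗ 𝔉.A J :=
  lift (𝔉.r _) (𝔉.pr (𝔉.r _ ≫ snd _ _) (𝔉.k _))

/-- `(i, j, k) ↦ (i, k)` -/
def π (I J : ℐ) : 𝔉.A (I ⊗ J) ⟶ 𝔉.A I :=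
  𝔉.pr (𝔉.r _ ≫ fst _ _) (𝔉.k _)

instance (I J : ℐ) : Mono (𝔉.d I J) where
  right_cancellation x y e := by
    have h₁ : x ≫ 𝔉.r _ = y ≫ 𝔉.r _ := by simpa [d] using e =≫ (fst _ _)
    have h₂ : x ≫ 𝔉.k _ = y ≫ 𝔉.k _ := by simpa [d] using e =≫ (snd _ _ ≫ 𝔉.k _)
    exact 𝔉.hom_ext h₁ h₂

lemma isPullback_left (I J K : ℐ) :
    IsPullback (lift (𝔉.r ((I ⊗ J) ⊗ K)) (𝔉.pr (𝔉.r _ ≫ snd _ _) (𝔉.k _)))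
      (𝔉.pr (lift (𝔉.r _ ≫ fst _ _ ≫ fst _ _) (𝔉.r _ ≫ snd _ _)) (𝔉.k _))
      ((lift (fst _ _ ≫ fst _ _) (snd _ _) : (I ⊗ J) ⊗ K ⟶ I ⊗ K) ⊗ₘ 𝟙 (𝔉.A K)) (𝔉.d I K) := by
  refine ⟨⟨?_⟩, ⟨Limits.PullbackCone.IsLimit.mk _ (fun s => 𝔉.pr (s.fst ≫ fst _ _)
    (s.snd ≫ 𝔉.k _)) (fun s => ?_) (fun s => ?_) (fun s m hm hm' => ?_)⟩⟩
  · apply CartesianMonoidalCategory.hom_ext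
    · apply CartesianMonoidalCategory.hom_ext <;> simp [d]
    · apply 𝔉.hom_ext <;> simp [d]
  all_goals
    have h₁ : s.fst ≫ fst _ _ ≫ fst _ _ ≫ fst _ _ = s.snd ≫ 𝔉.r _ ≫ fst _ _ := by
      simpa [d, π, -id_tensorHom] using s.condition =≫ (fst _ _ ≫ fst _ _)
    have h₂ : s.fst ≫ fst _ _ ≫ snd _ _ = s.snd ≫ 𝔉.r _ ≫ snd _ _ := by
      simpa [d, π, -id_tensorHom] using s.condition =≫ (fst _ _ ≫ snd _ _)
    have h₃ : s.fst ≫ snd _ _ ≫ 𝔉.r _ = s.snd ≫ 𝔉.r _ ≫ snd _ _ := by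
      simpa [d, π, -id_tensorHom] using s.condition =≫ (snd _ _ ≫ 𝔉.r _)
    have h₄ : s.fst ≫ snd _ _ ≫ 𝔉.k _ = s.snd ≫ 𝔉.k _ := by
      simpa [d, π, -id_tensorHom] using s.condition =≫ (snd _ _ ≫ 𝔉.k _)
  · apply CartesianMonoidalCategory.hom_ext
    · simp
    · apply 𝔉.hom_ext <;> simp [h₂, h₃, h₄]
  · apply 𝔉.hom_ext
    · apply CartesianMonoidalCategory.hom_ext <;> simp [h₁, h₂]
    · simp
  · apply 𝔉.hom_ext
    · simpa using hm =≫ (fst _ _)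
    · simpa using hm' =≫ (𝔉.k _)

lemma isPullback_right (I J K : ℐ) :
    IsPullback (lift (𝔉.r ((I ⊗ J) ⊗ K) ≫ fst _ _)
        (𝔉.pr (lift (𝔉.r _ ≫ fst _ _ ≫ snd _ _) (𝔉.r _ ≫ snd _ _)) (𝔉.k _)))
      (𝔉.pr (𝔉.r _ ≫ fst _ _) (𝔉.k _))
      (𝟙 (I ⊗ J) ⊗ₘ 𝔉.π J K) (𝔉.d I J) := by
  refine ⟨⟨?_⟩, ⟨Limits.PullbackCone.IsLimit.mk _ (fun s => 𝔉.pr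
    (lift (s.fst ≫ fst _ _) (s.fst ≫ snd _ _ ≫ 𝔉.r _ ≫ snd _ _))
    (s.snd ≫ 𝔉.k _)) (fun s => ?_) (fun s => ?_) (fun s m hm hm' => ?_)⟩⟩
  · apply CartesianMonoidalCategory.hom_ext
    · apply CartesianMonoidalCategory.hom_ext <;> simp [d, π, -id_tensorHom]
    · apply 𝔉.hom_ext <;> simp [d, π, -id_tensorHom]
  all_goals
    have h₁ : s.fst ≫ fst _ _ = s.snd ≫ 𝔉.r _ := by
      simpa [d, π, -id_tensorHom] using s.condition =≫ (fst _ _)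
    have h₃ : s.fst ≫ snd _ _ ≫ 𝔉.r _ ≫ fst _ _ = s.snd ≫ 𝔉.r _ ≫ snd _ _ := by
      simpa [d, π, -id_tensorHom] using s.condition =≫ (snd _ _ ≫ 𝔉.r _)
    have h₄ : s.fst ≫ snd _ _ ≫ 𝔉.k _ = s.snd ≫ 𝔉.k _ := by
      simpa [d, π, -id_tensorHom] using s.condition =≫ (snd _ _ ≫ 𝔉.k _)
  · apply CartesianMonoidalCategory.hom_ext
    · simp
    · apply 𝔉.hom_ext
      · apply CartesianMonoidalCategory.hom_ext <;> simp [h₁, h₃]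
      · simp [h₄]
  · apply 𝔉.hom_ext
    · simp [h₁]
    · simp
  · apply 𝔉.hom_ext
    · apply CartesianMonoidalCategory.hom_ext
      · simpa using hm =≫ (fst _ _)
      · simpa using hm =≫ (snd _ _ ≫ 𝔉.r _ ≫ snd _ _)
    · simpa using hm' =≫ (𝔉.k _)

end Frame

variable {𝓜 : Type u₁} [Category.{v₁} 𝓜] [MonoidalCategory 𝓜] {pM : 𝓜 ⥤ ℐ}
  {𝓔 : Type u₂} [Category.{v₂} 𝓔] [MonoidalLeftAction 𝓜 𝓔] {p : 𝓔 ⥤ ℐ}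

lemma isHomLift_act [Fibraction pM p] {M M' : 𝓜} {X X' : 𝓔} {f : M ⟶ M'} {g : X ⟶ X'}
    {A A' B B' : ℐ} {a : A ⟶ A'} {b : B ⟶ B'} (hf : pM.IsHomLift a f) (hg : p.IsHomLift b g) :
    p.IsHomLift (a ⊗ₘ b) (f ⊙ₗₘ g) := by
  cases hf; cases hg; exact Fibraction.actHom_isHomLift f g

lemma isHomLift_act_id [Fibraction pM p] {M M' : 𝓜} {X X' : 𝓔} {f : M ⟶ M'} {g : X ⟶ X'}
    {A B : ℐ} (hf : pM.IsHomLift (𝟙 A) f) (hg : p.IsHomLift (𝟙 B) g) :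
    p.IsHomLift (𝟙 (A ⊗ B)) (f ⊙ₗₘ g) := by
  simpa using isHomLift_act hf hg

lemma isHomLift_assoc [Fibraction pM p] {M N : 𝓜} {X : 𝓔} {A B C : ℐ} (hM : pM.obj M = A)
    (hN : pM.obj N = B) (hX : p.obj X = C) :
    p.IsHomLift (α_ A B C).hom (αₗ M N X).hom := by
  subst hM hN hX; exact Fibraction.assoc_isHomLift M N X

lemma isHomLift_unit [Fibraction pM p] {X : 𝓔} {C : ℐ} (hX : p.obj X = C) :
    p.IsHomLift (λ_ C).hom (λₗ[𝓜] X).hom := by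
  subst hX; exact Fibraction.unit_isHomLift (pM := pM) X

lemma PSpan.mono_of {E F : 𝓔} (σ : PSpan p E F) {S A : ℐ} {s : S ⟶ A} (h : p.IsHomLift s σ.c)
    (hs : Mono s) : Mono σ.c := by
  refine σ.cart.mono ?_
  cases h; exact hs

lemma PSpan.Sq.uniq_fiber {E F : 𝓔} {B : ℐ} {Y Y' : p.Fiber B} {σ : PSpan p E Y.1}
    {σ' : PSpan p F Y'.1} {f : E ⟶ F} {g g' : Y ⟶ Y'} (h : Sq σ σ' f g.1) (h' : Sq σ σ' f g'.1)
    (hm : Mono σ'.c) : g = g' :=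
  Subtype.ext (h.uniq h' hm ((map_eq_iff g.2 g'.2).2 rfl))

lemma PSpan.exists_hom {E F E' F' : 𝓔} (σ : PSpan p E F) (σ' : PSpan p E' F') (f : E ⟶ E')
    {S A B : ℐ} {s : S ⟶ A} {t : S ⟶ B} (hf : p.IsHomLift (𝟙 A) f)
    (hs : p.IsHomLift s σ.c) (hs' : p.IsHomLift s σ'.c)
    (ht : p.IsHomLift t σ.b) (ht' : p.IsHomLift t σ'.b) :
    ∃ g : F ⟶ F', p.IsHomLift (𝟙 B) g ∧ Sq σ σ' f g := by
  obtain ⟨θ, hθ, eθ⟩ := σ'.cart.lift hs' (ψ := σ.c ≫ f) (g := s) inferInstance (𝟙 S)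
    (Category.id_comp _)
  obtain ⟨g, hg, eg⟩ := σ.opcart.desc ht (ψ := θ ≫ σ'.b) (g := 𝟙 S ≫ t) inferInstance (𝟙 B)
    (by simp)
  exact ⟨g, hg, θ, eθ, eg.symm⟩

variable (pM p) in
/-- A choice, for all "matrices" `M` over `I ⊗ J` and all "vectors" `X` over `A J`, of a product
`act M X` over `A I`: restrict `M • X` along `(i, j, k) ↦ ((i, j), (j, k))`, then push forward
along `(i, j, k) ↦ (i, k)`. -/
structure MatAction (𝔉 : Frame ℐ) where
  act {I J : ℐ} (M : pM.Fiber (I ⊗ J)) (X : p.Fiber (𝔉.A J)) : p.Fiber (𝔉.A I)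
  span {I J : ℐ} (M : pM.Fiber (I ⊗ J)) (X : p.Fiber (𝔉.A J)) :
    PSpan p (M.1 ⊙ₗ X.1) (act M X).1
  c_lift {I J : ℐ} (M : pM.Fiber (I ⊗ J)) (X : p.Fiber (𝔉.A J)) :
    p.IsHomLift (𝔉.d I J) (span M X).c
  b_lift {I J : ℐ} (M : pM.Fiber (I ⊗ J)) (X : p.Fiber (𝔉.A J)) :
    p.IsHomLift (𝔉.π I J) (span M X).b

namespace MatAction

variable {𝔉 : Frame ℐ} (𝒳 : MatAction pM p 𝔉) {I J K L : ℐ}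

lemma mono (M : pM.Fiber (I ⊗ J)) (X : p.Fiber (𝔉.A J)) : Mono (𝒳.span M X).c :=
  PSpan.mono_of _ (𝒳.c_lift M X) inferInstance

section map

variable [Fibraction pM p] {M M' M'' : pM.Fiber (I ⊗ J)} {X X' X'' : p.Fiber (𝔉.A J)}

lemma exists_map (f : M ⟶ M') (g : X ⟶ X') : ∃ h : 𝒳.act M X ⟶ 𝒳.act M' X',
    (𝒳.span M X).Sq (𝒳.span M' X') (f.1 ⊙ₗₘ g.1) h.1 := by
  obtain ⟨h, hh, e⟩ := PSpan.exists_hom (𝒳.span M X) (𝒳.span M' X') (f.1 ⊙ₗₘ g.1)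
    (isHomLift_act_id f.2 g.2) (𝒳.c_lift _ _) (𝒳.c_lift _ _) (𝒳.b_lift _ _) (𝒳.b_lift _ _)
  exact ⟨⟨h, hh⟩, e⟩

/-- Functoriality of the matrix action. -/
noncomputable def map (f : M ⟶ M') (g : X ⟶ X') : 𝒳.act M X ⟶ 𝒳.act M' X' :=
  (𝒳.exists_map f g).choose

lemma map_sq (f : M ⟶ M') (g : X ⟶ X') :
    (𝒳.span M X).Sq (𝒳.span M' X') (f.1 ⊙ₗₘ g.1) (𝒳.map f g).1 :=
  (𝒳.exists_map f g).choose_spec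

lemma map_id (M : pM.Fiber (I ⊗ J)) (X : p.Fiber (𝔉.A J)) : 𝒳.map (𝟙 M) (𝟙 X) = 𝟙 _ := by
  refine (𝒳.map_sq _ _).uniq_fiber ?_ (𝒳.mono _ _)
  have := PSpan.Sq.refl (𝒳.span M X)
  convert this
  · exact (MonoidalLeftAction.id_actionHom _ _).trans (MonoidalLeftAction.actionHomRight_id _ _)
  · rfl

lemma map_comp (f : M ⟶ M') (f' : M' ⟶ M'') (g : X ⟶ X') (g' : X' ⟶ X'') :
    𝒳.map (f ≫ f') (g ≫ g') = 𝒳.map f g ≫ 𝒳.map f' g' := by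
  refine (𝒳.map_sq _ _).uniq_fiber ?_ (𝒳.mono _ _)
  have := (𝒳.map_sq f g).trans (𝒳.map_sq f' g')
  rw [← MonoidalLeftAction.actionHom_comp] at this
  exact this

end map

end MatAction

section System

lemma isHomLift_rho [MonoidalBifibration pM] {M : 𝓜} {A : ℐ} (hM : pM.obj M = A) :
    pM.IsHomLift (ρ_ A).hom (ρ_ M).hom := by
  subst hM; exact MonoidalBifibration.rightUnitor_isHomLift M

variable (pM) in
/-- A choice of composites `mul` and identities `one` for matrices. -/
structure MatSystem where
  mul (K : ℐ) : MatAction pM pM (Frame.prod K)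
  one (I : ℐ) : pM.Fiber (I ⊗ I)
  oneSpan (I : ℐ) : PSpan pM (𝟙_ 𝓜) (one I).1
  one_c (I : ℐ) : pM.IsHomLift (toUnit I) (oneSpan I).c
  one_b (I : ℐ) : pM.IsHomLift (lift (𝟙 I) (𝟙 I)) (oneSpan I).b

variable [Limits.HasPullbacks ℐ] [MonoidalBifibration pM] [BeckChevalley pM]
  [p.IsFibered] [BeckChevalley p] [Fibraction pM p]
  (𝒮 : MatSystem pM) {𝔉 : Frame ℐ} (𝒳 : MatAction pM p 𝔉) {I J K L : ℐ}

namespace MatAction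

/-- The span exhibiting `(M ⊙ N) · X` as obtained from `(M ⊗ N) • X`. -/
noncomputable abbrev spanL (M : pM.Fiber (I ⊗ J)) (N : pM.Fiber (J ⊗ K)) (X : p.Fiber (𝔉.A K)) :
    PSpan p ((M.1 ⊗ N.1) ⊙ₗ X.1) (𝒳.act ((𝒮.mul K).act M N) X).1 :=
  (((𝒮.mul K).span M N).act (.id X.1)).comp (𝒳.span ((𝒮.mul K).act M N) X)

/-- The span exhibiting `M · (N · X)` as obtained from `M • (N • X)`. -/
noncomputable abbrev spanR (M : pM.Fiber (I ⊗ J)) (N : pM.Fiber (J ⊗ K)) (X : p.Fiber (𝔉.A K)) :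
    PSpan p (M.1 ⊙ₗ (N.1 ⊙ₗ X.1)) (𝒳.act M (𝒳.act N X)).1 :=
  ((.id M.1 : PSpan pM _ _).act (𝒳.span N X)).comp (𝒳.span M (𝒳.act N X))

lemma exists_assoc (M : pM.Fiber (I ⊗ J)) (N : pM.Fiber (J ⊗ K)) (X : p.Fiber (𝔉.A K)) :
    ∃ a : 𝒳.act ((𝒮.mul K).act M N) X ≅ 𝒳.act M (𝒳.act N X),
      (spanL 𝒮 𝒳 M N X).Sq (spanR 𝒳 M N X) (αₗ _ _ _).hom a.hom.1 ∧
      (spanR 𝒳 M N X).Sq (spanL 𝒮 𝒳 M N X) (αₗ _ _ _).inv a.inv.1 := by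
  have hX : p.IsHomLift (𝟙 (𝔉.A K)) (𝟙 X.1) := IsHomLift.id X.2
  have hM : pM.IsHomLift (𝟙 (I ⊗ J)) (𝟙 M.1) := IsHomLift.id M.2
  obtain ⟨σ, h₁, h₂, h₃, h₄⟩ := PSpan.exists_typed_comp
    (((𝒮.mul K).span M N).act (.id X.1)) (𝒳.span ((𝒮.mul K).act M N) X)
    (isHomLift_act ((𝒮.mul K).c_lift M N) hX) (isHomLift_act ((𝒮.mul K).b_lift M N) hX)
    (𝒳.c_lift _ _) (𝒳.b_lift _ _) (𝔉.isPullback_left I J K)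
  obtain ⟨τ, k₁, k₂, k₃, k₄⟩ := PSpan.exists_typed_comp
    ((.id M.1 : PSpan pM _ _).act (𝒳.span N X)) (𝒳.span M (𝒳.act N X))
    (isHomLift_act hM (𝒳.c_lift N X)) (isHomLift_act hM (𝒳.b_lift N X))
    (𝒳.c_lift _ _) (𝒳.b_lift _ _) (𝔉.isPullback_right I J K)
  have e : 𝔉.pr (lift (𝔉.r ((I ⊗ J) ⊗ K) ≫ fst _ _ ≫ fst _ _) (𝔉.r _ ≫ snd _ _)) (𝔉.k _) ≫
      𝔉.π I K = 𝔉.pr (𝔉.r _ ≫ fst _ _) (𝔉.k _) ≫ 𝔉.π I J := by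
    apply 𝔉.hom_ext <;> simp [Frame.π]
  rw [← e] at k₂
  obtain ⟨g, hg, s₁, s₂⟩ := PSpan.exists_iso σ τ (αₗ M.1 N.1 X.1)
    (isHomLift_assoc M.2 N.2 X.2) h₁ k₁ (by
      apply CartesianMonoidalCategory.hom_ext
      · apply CartesianMonoidalCategory.hom_ext <;> simp [Frame.d, -id_tensorHom]
      · apply CartesianMonoidalCategory.hom_ext
        · apply CartesianMonoidalCategory.hom_ext <;> simp [Frame.d, -id_tensorHom]
        · apply 𝔉.hom_ext <;> simp [Frame.d, -id_tensorHom]) h₂ k₂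
  exact ⟨⟨⟨g.hom, hg⟩, ⟨g.inv, inferInstance⟩, Subtype.ext g.hom_inv_id,
    Subtype.ext g.inv_hom_id⟩, h₄.pre (s₁.post k₃), k₄.pre (s₂.post h₃)⟩

/-- The canonical isomorphism `(M ⊙ N) · X ≅ M · (N · X)`. -/
noncomputable def assoc (M : pM.Fiber (I ⊗ J)) (N : pM.Fiber (J ⊗ K)) (X : p.Fiber (𝔉.A K)) :
    𝒳.act ((𝒮.mul K).act M N) X ≅ 𝒳.act M (𝒳.act N X) :=
  (exists_assoc 𝒮 𝒳 M N X).choose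

lemma assoc_sq (M : pM.Fiber (I ⊗ J)) (N : pM.Fiber (J ⊗ K)) (X : p.Fiber (𝔉.A K)) :
    (spanL 𝒮 𝒳 M N X).Sq (spanR 𝒳 M N X) (αₗ _ _ _).hom (assoc 𝒮 𝒳 M N X).hom.1 :=
  (exists_assoc 𝒮 𝒳 M N X).choose_spec.1

/-- The span exhibiting `1 · X` as obtained from `𝟙 • X`. -/
noncomputable abbrev spanU (X : p.Fiber (𝔉.A I)) :
    PSpan p (𝟙_ 𝓜 ⊙ₗ X.1) (𝒳.act (𝒮.one I) X).1 :=
  ((𝒮.oneSpan I).act (.id X.1)).comp (𝒳.span (𝒮.one I) X)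

lemma isPullback_unit (𝔉 : Frame ℐ) (I : ℐ) :
    IsPullback (lift (𝔉.r I) (𝟙 (𝔉.A I))) (𝔉.pr (lift (𝔉.r I) (𝔉.r I)) (𝔉.k I))
      (lift (𝟙 I) (𝟙 I) ⊗ₘ 𝟙 (𝔉.A I)) (𝔉.d I I) := by
  refine ⟨⟨?_⟩, ⟨Limits.PullbackCone.IsLimit.mk _ (fun s => s.fst ≫ snd _ _)
    (fun s => ?_) (fun s => ?_) (fun s m hm hm' => ?_)⟩⟩
  · apply CartesianMonoidalCategory.hom_ext
    · apply CartesianMonoidalCategory.hom_ext <;> simp [Frame.d]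
    · apply 𝔉.hom_ext <;> simp [Frame.d]
  all_goals
    have h₁ : s.fst ≫ fst _ _ = s.snd ≫ 𝔉.r _ ≫ fst _ _ := by
      simpa [Frame.d] using s.condition =≫ (fst _ _ ≫ fst _ _)
    have h₂ : s.fst ≫ fst _ _ = s.snd ≫ 𝔉.r _ ≫ snd _ _ := by
      simpa [Frame.d] using s.condition =≫ (fst _ _ ≫ snd _ _)
    have h₃ : s.fst ≫ snd _ _ ≫ 𝔉.r _ = s.snd ≫ 𝔉.r _ ≫ snd _ _ := by
      simpa [Frame.d] using s.condition =≫ (snd _ _ ≫ 𝔉.r _)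
    have h₄ : s.fst ≫ snd _ _ ≫ 𝔉.k _ = s.snd ≫ 𝔉.k _ := by
      simpa [Frame.d] using s.condition =≫ (snd _ _ ≫ 𝔉.k _)
  · apply CartesianMonoidalCategory.hom_ext
    · simp [h₃, h₂]
    · simp
  · apply 𝔉.hom_ext
    · apply CartesianMonoidalCategory.hom_ext <;> simp [h₁.symm.trans h₂, h₃]
    · simp [h₄]
  · simpa using hm =≫ snd _ _

lemma exists_unit (X : p.Fiber (𝔉.A I)) : ∃ l : 𝒳.act (𝒮.one I) X ≅ X,
    (spanU 𝒮 𝒳 X).Sq (.id X.1) (λₗ[𝓜] X.1).hom l.hom.1 := by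
  have hX : p.IsHomLift (𝟙 (𝔉.A I)) (𝟙 X.1) := IsHomLift.id X.2
  obtain ⟨σ, h₁, h₂, h₃, h₄⟩ := PSpan.exists_typed_comp
    ((𝒮.oneSpan I).act (.id X.1)) (𝒳.span (𝒮.one I) X)
    (isHomLift_act (𝒮.one_c I) hX) (isHomLift_act (𝒮.one_b I) hX)
    (𝒳.c_lift _ _) (𝒳.b_lift _ _) (isPullback_unit 𝔉 I)
  have e : 𝔉.pr (lift (𝔉.r I) (𝔉.r I)) (𝔉.k I) ≫ 𝔉.π I I = 𝟙 _ := by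
    apply 𝔉.hom_ext <;> simp [Frame.π]
  rw [e] at h₂
  obtain ⟨g, hg, s₁, s₂⟩ := PSpan.exists_iso σ (.id X.1) (λₗ[𝓜] X.1)
    (isHomLift_unit (pM := pM) X.2) h₁ hX (by simp) h₂ hX
  exact ⟨⟨⟨g.hom, hg⟩, ⟨g.inv, inferInstance⟩, Subtype.ext g.hom_inv_id,
    Subtype.ext g.inv_hom_id⟩, h₄.pre s₁⟩

/-- The canonical isomorphism `1 · X ≅ X`. -/
noncomputable def unit (X : p.Fiber (𝔉.A I)) : 𝒳.act (𝒮.one I) X ≅ X :=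
  (exists_unit 𝒮 𝒳 X).choose

lemma unit_sq (X : p.Fiber (𝔉.A I)) :
    (spanU 𝒮 𝒳 X).Sq (.id X.1) (λₗ[𝓜] X.1).hom (unit 𝒮 𝒳 X).hom.1 :=
  (exists_unit 𝒮 𝒳 X).choose_spec

end MatAction

namespace MatSystem

/-- The span exhibiting `M ⊙ 1` as obtained from `M ⊗ 𝟙`. -/
noncomputable abbrev spanV (M : pM.Fiber (I ⊗ J)) :
    PSpan pM (M.1 ⊗ 𝟙_ 𝓜) ((𝒮.mul J).act M (𝒮.one J)).1 :=
  ((.id M.1 : PSpan pM _ _).tensor (𝒮.oneSpan J)).comp ((𝒮.mul J).span M (𝒮.one J))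

lemma isPullback_unit (I J : ℐ) :
    IsPullback (lift (𝟙 (I ⊗ J)) (snd I J)) (lift (𝟙 (I ⊗ J)) (snd I J))
      (𝟙 (I ⊗ J) ⊗ₘ lift (𝟙 J) (𝟙 J)) ((Frame.prod J).d I J) := by
  refine ⟨⟨?_⟩, ⟨Limits.PullbackCone.IsLimit.mk _ (fun s => s.fst ≫ fst _ _)
    (fun s => ?_) (fun s => ?_) (fun s m hm hm' => ?_)⟩⟩
  · apply CartesianMonoidalCategory.hom_ext
    · simp [Frame.d, -id_tensorHom]
    · apply CartesianMonoidalCategory.hom_ext <;> simp [Frame.d, -id_tensorHom]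
  all_goals
    have h₁ : s.fst ≫ fst _ _ = s.snd ≫ fst _ _ := by
      simpa [Frame.d, -id_tensorHom] using s.condition =≫ (fst _ _)
    have h₂ : s.fst ≫ snd _ _ = s.snd ≫ fst _ _ ≫ snd _ _ := by
      simpa [Frame.d, -id_tensorHom] using s.condition =≫ (snd _ _ ≫ fst _ _)
    have h₃ : s.fst ≫ snd _ _ = s.snd ≫ snd _ _ := by
      simpa [Frame.d, -id_tensorHom] using s.condition =≫ (snd _ _ ≫ snd _ _)
    have h₁' := h₁ =≫ snd _ _
    simp only [Category.assoc] at h₁'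
  · apply CartesianMonoidalCategory.hom_ext
    · simp
    · simp [h₁', h₂]
  · apply CartesianMonoidalCategory.hom_ext
    · simp [h₁]
    · simp [h₁', ← h₃, h₂]
  · simpa using hm =≫ fst _ _

lemma exists_unit (M : pM.Fiber (I ⊗ J)) : ∃ l : (𝒮.mul J).act M (𝒮.one J) ≅ M,
    (spanV 𝒮 M).Sq (.id M.1) (ρ_ M.1).hom l.hom.1 := by
  have hM : pM.IsHomLift (𝟙 (I ⊗ J)) (𝟙 M.1) := IsHomLift.id M.2
  obtain ⟨σ, h₁, h₂, h₃, h₄⟩ := PSpan.exists_typed_comp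
    ((.id M.1 : PSpan pM _ _).tensor (𝒮.oneSpan J)) ((𝒮.mul J).span M (𝒮.one J))
    (isHomLift_act hM (𝒮.one_c J)) (isHomLift_act hM (𝒮.one_b J))
    ((𝒮.mul J).c_lift _ _) ((𝒮.mul J).b_lift _ _) (isPullback_unit I J)
  have e : lift (𝟙 (I ⊗ J)) (snd I J) ≫ (Frame.prod J).π I J = 𝟙 _ := by
    apply CartesianMonoidalCategory.hom_ext <;> simp [Frame.π]
  rw [e] at h₂
  have hρ : pM.IsHomLift (ρ_ (I ⊗ J)).hom (ρ_ M.1).hom := isHomLift_rho M.2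
  obtain ⟨g, hg, s₁, s₂⟩ := PSpan.exists_iso σ (.id M.1) (ρ_ M.1)
    hρ h₁ hM (by simp [-id_tensorHom]) h₂ hM
  exact ⟨⟨⟨g.hom, hg⟩, ⟨g.inv, inferInstance⟩, Subtype.ext g.hom_inv_id,
    Subtype.ext g.inv_hom_id⟩, h₄.pre s₁⟩

/-- The canonical isomorphism `M ⊙ 1 ≅ M`. -/
noncomputable def unitR (M : pM.Fiber (I ⊗ J)) : (𝒮.mul J).act M (𝒮.one J) ≅ M :=
  (exists_unit 𝒮 M).choose

lemma unitR_sq (M : pM.Fiber (I ⊗ J)) :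
    (spanV 𝒮 M).Sq (.id M.1) (ρ_ M.1).hom (unitR 𝒮 M).hom.1 :=
  (exists_unit 𝒮 M).choose_spec

end MatSystem

end System

end Matrices
section Coherence

variable {ℐ : Type u₀} [Category.{v₀} ℐ] [CartesianMonoidalCategory ℐ]
  {𝓜 : Type u₁} [Category.{v₁} 𝓜] [MonoidalCategory 𝓜] {pM : 𝓜 ⥤ ℐ}
  {𝓔 : Type u₂} [Category.{v₂} 𝓔] [MonoidalLeftAction 𝓜 𝓔] {p : 𝓔 ⥤ ℐ}
  [Limits.HasPullbacks ℐ] [MonoidalBifibration pM] [BeckChevalley pM]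
  [p.IsFibered] [BeckChevalley p] [Fibraction pM p]
  (𝒮 : MatSystem pM) {𝔉 : Frame ℐ} (𝒳 : MatAction pM p 𝔉) {I J K L : ℐ}

lemma PSpan.Sq.uniq_fiber' {E F : 𝓔} {B : ℐ} {Y Y' : p.Fiber B} {σ : PSpan p E Y.1}
    {σ' : PSpan p F Y'.1} {f f' : E ⟶ F} {g g' : Y ⟶ Y'} (h : Sq σ σ' f g.1)
    (h' : Sq σ σ' f' g'.1) (e : f = f') (hm : Mono σ'.c) : g = g' := by
  subst e; exact h.uniq_fiber h' hm

namespace PSpan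

section

variable {C : Type u₃} [Category.{v₃} C] {q : C ⥤ ℐ} [q.IsFibered] [BeckChevalley q]
variable {E F G H E' F' G' : C}

lemma Sq.hcomp₁ {σ σ' : PSpan q E F} (H : Sq σ σ' (𝟙 _) (𝟙 _)) (τ : PSpan q F G) :
    Sq (σ.comp τ) (σ'.comp τ) (𝟙 _) (𝟙 _) := H.hcomp (Sq.refl τ)

lemma Sq.hcomp₂ (σ : PSpan q E F) {τ τ' : PSpan q F G} (H : Sq τ τ' (𝟙 _) (𝟙 _)) :
    Sq (σ.comp τ) (σ.comp τ') (𝟙 _) (𝟙 _) := (Sq.refl σ).hcomp H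

end

lemma Sq.act' {A B : 𝓜} {E F : 𝓔} {σ σ' : PSpan pM A B} {τ τ' : PSpan p E F}
    (H : Sq σ σ' (𝟙 _) (𝟙 _)) (K : Sq τ τ' (𝟙 _) (𝟙 _)) :
    Sq (σ.act τ) (σ'.act τ') (𝟙 _) (𝟙 _) := by
  simpa using H.act K

lemma mono_comp_c {E F G : 𝓔} (σ : PSpan p E F) (τ : PSpan p F G) (h : Mono (p.map σ.c))
    (h' : Mono (p.map τ.c)) : Mono (σ.comp τ).c :=
  (σ.comp τ).cart.mono (mono_comp h h')

end PSpan

open PSpan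

namespace MatAction

lemma mono_map (M : pM.Fiber (I ⊗ J)) (X : p.Fiber (𝔉.A J)) : Mono (p.map (𝒳.span M X).c) := by
  have h := 𝒳.c_lift M X
  obtain h' := (inferInstance : Mono (𝔉.d I J))
  generalize 𝔉.d I J = d at h h'
  generalize (𝒳.span M X).c = c at h ⊢
  rw [IsHomLift.fac' p d c]
  infer_instance

lemma mono_spanR (M : pM.Fiber (I ⊗ J)) (N : pM.Fiber (J ⊗ K)) (X : p.Fiber (𝔉.A K)) :
    Mono (spanR 𝒳 M N X).c :=
  mono_comp_c _ _ (mono_act (mono_id M.1) (𝒳.mono_map N X)) (𝒳.mono_map _ _)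

lemma assoc_naturality {M M' : pM.Fiber (I ⊗ J)} {N N' : pM.Fiber (J ⊗ K)}
    {X X' : p.Fiber (𝔉.A K)} (f : M ⟶ M') (g : N ⟶ N') (h : X ⟶ X') :
    𝒳.map ((𝒮.mul K).map f g) h ≫ (assoc 𝒮 𝒳 M' N' X').hom =
      (assoc 𝒮 𝒳 M N X).hom ≫ 𝒳.map f (𝒳.map g h) := by
  have h₁ := ((((𝒮.mul K).map_sq f g).act (Sq.idSq h.1)).hcomp
    (𝒳.map_sq ((𝒮.mul K).map f g) h)).trans (assoc_sq 𝒮 𝒳 M' N' X')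
  have h₂ := (assoc_sq 𝒮 𝒳 M N X).trans
    (((Sq.idSq f.1).act (𝒳.map_sq g h)).hcomp (𝒳.map_sq f (𝒳.map g h)))
  exact h₁.uniq_fiber' h₂ (MonoidalLeftAction.actionAssocIso_hom_naturality f.1 g.1 h.1)
    (mono_spanR _ _ _ _)

lemma unit_naturality {X X' : p.Fiber (𝔉.A I)} (h : X ⟶ X') :
    𝒳.map (𝟙 _) h ≫ (unit 𝒮 𝒳 X').hom = (unit 𝒮 𝒳 X).hom ≫ h := by
  have h₁ := ((((Sq.refl (𝒮.oneSpan I)).act (Sq.idSq h.1)).hcomp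
    (𝒳.map_sq (𝟙 (𝒮.one I)) h)).trans (unit_sq 𝒮 𝒳 X'))
  have h₂ := (unit_sq 𝒮 𝒳 X).trans (Sq.idSq h.1)
  refine h₁.uniq_fiber' h₂ ?_ (inferInstanceAs (Mono (𝟙 _)))
  rw [MonoidalLeftAction.id_actionHom, MonoidalLeftAction.actionUnitIso_hom_naturality]

lemma pentagon (M : pM.Fiber (I ⊗ J)) (N : pM.Fiber (J ⊗ K)) {J' : ℐ} (P : pM.Fiber (K ⊗ J'))
    (X : p.Fiber (𝔉.A J')) :
    (assoc 𝒮 𝒳 ((𝒮.mul K).act M N) P X).hom ≫ (assoc 𝒮 𝒳 M N (𝒳.act P X)).hom =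
      𝒳.map (assoc 𝒮 (𝒮.mul J') M N P).hom (𝟙 X) ≫
        (assoc 𝒮 𝒳 M ((𝒮.mul J').act N P) X).hom ≫ 𝒳.map (𝟙 M) (assoc 𝒮 𝒳 N P X).hom := by
  let iM : PSpan pM M.1 M.1 := .id M.1
  let iN : PSpan pM N.1 N.1 := .id N.1
  let iP : PSpan pM P.1 P.1 := .id P.1
  let iX : PSpan p X.1 X.1 := .id X.1
  let μ₁ := (𝒮.mul K).span M N
  let MN := (𝒮.mul K).act M N
  let NP := (𝒮.mul J').act N P
  let MN' : PSpan pM MN.1 MN.1 := .id MN.1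
  let PX := 𝒳.act P X
  let σ₁ : PSpan p (((M.1 ⊗ N.1) ⊗ P.1) ⊙ₗ X.1) ((MN.1 ⊗ P.1) ⊙ₗ X.1) := (μ₁.tensor iP).act iX
  let S₀ := σ₁.comp (spanL 𝒮 𝒳 MN P X)
  let ξ := 𝒳.span P X
  let T₀ := (iM.act (iN.act ξ)).comp (spanR 𝒳 M N PX)
  have A : Sq S₀ T₀ ((αₗ (M.1 ⊗ N.1) P.1 X.1).hom ≫ (αₗ M.1 N.1 (P.1 ⊙ₗ X.1)).hom)
      ((assoc 𝒮 𝒳 MN P X).hom.1 ≫ (assoc 𝒮 𝒳 M N PX).hom.1) := by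
    have a₁ := (act_assoc μ₁ iP iX).hcomp (assoc_sq 𝒮 𝒳 MN P X)
    have g₁ : Sq ((μ₁.act (iP.act iX)).comp (spanR 𝒳 MN P X))
        (((μ₁.act (.id (P.1 ⊙ₗ X.1))).comp (MN'.act ξ)).comp (𝒳.span MN PX)) (𝟙 _) (𝟙 _) :=
      ((Sq.act' (Sq.refl μ₁) (id_act_id P.1 X.1)).hcomp₁ _).post (assoc' _ _ _)
    have g₂ : Sq (((μ₁.act (.id (P.1 ⊙ₗ X.1))).comp (MN'.act ξ)).comp (𝒳.span MN PX))
        (((iM.tensor iN).act ξ).comp (spanL 𝒮 𝒳 M N PX)) (𝟙 _) (𝟙 _) :=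
      (((act_interchange μ₁ ξ).hcomp₁ _).post (PSpan.assoc _ _ _)).post
        ((Sq.act' (id_act_id' M.1 N.1) (Sq.refl ξ)).hcomp₁ _)
    have a₂ := (act_assoc iM iN ξ).hcomp (assoc_sq 𝒮 𝒳 M N PX)
    exact ((a₁.post g₁).post g₂).trans a₂
  have B : Sq S₀ T₀ (((α_ M.1 N.1 P.1).hom ⊙ₗₘ 𝟙 X.1) ≫ (αₗ M.1 (N.1 ⊗ P.1) X.1).hom ≫
        (𝟙 M.1 ⊙ₗₘ (αₗ N.1 P.1 X.1).hom))
      ((𝒳.map (assoc 𝒮 (𝒮.mul J') M N P).hom (𝟙 X)).1 ≫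
        (assoc 𝒮 𝒳 M NP X).hom.1 ≫ (𝒳.map (𝟙 M) (assoc 𝒮 𝒳 N P X).hom).1) := by
    have g₁ : Sq S₀ (((spanL 𝒮 (𝒮.mul J') M N P).act iX).comp (𝒳.span _ X)) (𝟙 _) (𝟙 _) :=
      (assoc' _ _ _).post (((act_comp_act _ _ iX iX).post
        (Sq.act' (Sq.refl _) (id_comp iX))).hcomp₁ _)
    have a₁ := ((assoc_sq 𝒮 (𝒮.mul J') M N P).act (Sq.refl iX)).hcomp
      (𝒳.map_sq (assoc 𝒮 (𝒮.mul J') M N P).hom (𝟙 X))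
    have g₂ : Sq (((spanR (𝒮.mul J') M N P).act iX).comp (𝒳.span _ X))
        (((iM.tensor ((𝒮.mul J').span N P)).act iX).comp (spanL 𝒮 𝒳 M NP X)) (𝟙 _) (𝟙 _) :=
      (((Sq.act' (Sq.refl _) (id_comp' iX)).post (comp_act_comp _ _ iX iX)).hcomp₁ _).post
        (PSpan.assoc _ _ _)
    have a₂ := (act_assoc iM ((𝒮.mul J').span N P) iX).hcomp (assoc_sq 𝒮 𝒳 M NP X)
    have g₃ : Sq ((iM.act (((𝒮.mul J').span N P).act iX)).comp (spanR 𝒳 M NP X))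
        ((iM.act (spanL 𝒮 𝒳 N P X)).comp (𝒳.span M (𝒳.act NP X))) (𝟙 _) (𝟙 _) :=
      (assoc' _ _ _).post (((act_comp_act iM iM _ _).post
        (Sq.act' (id_comp iM) (Sq.refl _))).hcomp₁ _)
    have a₃ := ((Sq.refl iM).act (assoc_sq 𝒮 𝒳 N P X)).hcomp
      (𝒳.map_sq (𝟙 M) (assoc 𝒮 𝒳 N P X).hom)
    have g₄ : Sq ((iM.act (spanR 𝒳 N P X)).comp (𝒳.span M _)) T₀ (𝟙 _) (𝟙 _) :=
      (((Sq.act' (id_comp' iM) (Sq.refl _)).post (comp_act_comp iM iM _ _)).hcomp₁ _).post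
        (PSpan.assoc _ _ _)
    have := (g₁.pre a₁).trans ((g₂.pre a₂).trans ((g₃.pre a₃).post g₄))
    exact this
  refine A.uniq_fiber' B ?_ ?_
  · rw [MonoidalLeftAction.actionHom_id, MonoidalLeftAction.id_actionHom] 
    exact (MonoidalLeftAction.associator_actionHom _ _ _ _).symm
  · exact mono_comp_c _ _ (mono_act (mono_id _) (mono_act (mono_id _) (𝒳.mono_map _ _)))
      (mono_comp (mono_act (mono_id _) (𝒳.mono_map _ _)) (𝒳.mono_map _ _))

lemma triangle (M : pM.Fiber (I ⊗ J)) (X : p.Fiber (𝔉.A J)) :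
    (assoc 𝒮 𝒳 M (𝒮.one J) X).hom ≫ 𝒳.map (𝟙 M) (unit 𝒮 𝒳 X).hom =
      𝒳.map (𝒮.unitR M).hom (𝟙 X) := by
  let iM : PSpan pM M.1 M.1 := .id M.1
  let iX : PSpan p X.1 X.1 := .id X.1
  let u := 𝒮.oneSpan J
  let σ₁ : PSpan p ((M.1 ⊗ 𝟙_ 𝓜) ⊙ₗ X.1) ((M.1 ⊗ (𝒮.one J).1) ⊙ₗ X.1) := (iM.tensor u).act iX
  let S₀ := σ₁.comp (spanL 𝒮 𝒳 M (𝒮.one J) X)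
  have g₀ : Sq ((iM.act iX).comp (𝒳.span M X)) (𝒳.span M X) (𝟙 _) (𝟙 _) :=
    ((id_act_id M.1 X.1).hcomp₁ _).post (id_comp _)
  have A : Sq S₀ (𝒳.span M X) ((αₗ M.1 (𝟙_ 𝓜) X.1).hom ≫ (𝟙 M.1 ⊙ₗₘ (λₗ[𝓜] X.1).hom))
      ((assoc 𝒮 𝒳 M (𝒮.one J) X).hom.1 ≫ (𝒳.map (𝟙 M) (unit 𝒮 𝒳 X).hom).1) := by
    have a₁ := (act_assoc iM u iX).hcomp (assoc_sq 𝒮 𝒳 M (𝒮.one J) X)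
    have g₁ : Sq ((iM.act (u.act iX)).comp (spanR 𝒳 M (𝒮.one J) X))
        ((iM.act (spanU 𝒮 𝒳 X)).comp (𝒳.span M (𝒳.act (𝒮.one J) X))) (𝟙 _) (𝟙 _) :=
      (assoc' _ _ _).post (((act_comp_act iM iM _ _).post
        (Sq.act' (id_comp iM) (Sq.refl _))).hcomp₁ _)
    have a₂ := ((Sq.refl iM).act (unit_sq 𝒮 𝒳 X)).hcomp (𝒳.map_sq (𝟙 M) (unit 𝒮 𝒳 X).hom)
    exact (a₁.post g₁).trans (a₂.post g₀)
  have B : Sq S₀ (𝒳.span M X) ((ρ_ M.1).hom ⊙ₗₘ 𝟙 X.1) (𝒳.map (𝒮.unitR M).hom (𝟙 X)).1 := by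
    have g₁ : Sq S₀ (((𝒮.spanV M).act iX).comp (𝒳.span _ X)) (𝟙 _) (𝟙 _) :=
      (assoc' _ _ _).post (((act_comp_act _ _ iX iX).post
        (Sq.act' (Sq.refl _) (id_comp iX))).hcomp₁ _)
    have a₁ := ((𝒮.unitR_sq M).act (Sq.refl iX)).hcomp (𝒳.map_sq (𝒮.unitR M).hom (𝟙 X))
    exact g₁.pre (a₁.post g₀)
  refine A.uniq_fiber' B ?_ (𝒳.mono _ _)
  rw [MonoidalLeftAction.actionHom_id, MonoidalLeftAction.id_actionHom]
  exact (MonoidalLeftAction.rightUnitor_actionHom _ _).symm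

lemma assoc_one (M : pM.Fiber (I ⊗ J)) (X : p.Fiber (𝔉.A J)) :
    (assoc 𝒮 𝒳 (𝒮.one I) M X).hom ≫ (unit 𝒮 𝒳 (𝒳.act M X)).hom =
      𝒳.map (unit 𝒮 (𝒮.mul J) M).hom (𝟙 X) := by
  let iM : PSpan pM M.1 M.1 := .id M.1
  let iX : PSpan p X.1 X.1 := .id X.1
  let u := 𝒮.oneSpan I
  let ξ := 𝒳.span M X
  let i₀ : PSpan pM (𝟙_ 𝓜) (𝟙_ 𝓜) := .id _
  let i₁ : PSpan pM (𝒮.one I).1 (𝒮.one I).1 := .id _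
  let σ₁ : PSpan p ((𝟙_ 𝓜 ⊗ M.1) ⊙ₗ X.1) (((𝒮.one I).1 ⊗ M.1) ⊙ₗ X.1) := (u.tensor iM).act iX
  let S₀ := σ₁.comp (spanL 𝒮 𝒳 (𝒮.one I) M X)
  have A : Sq S₀ ξ ((αₗ (𝟙_ 𝓜) M.1 X.1).hom ≫ (λₗ[𝓜] (M.1 ⊙ₗ X.1)).hom)
      ((assoc 𝒮 𝒳 (𝒮.one I) M X).hom.1 ≫ (unit 𝒮 𝒳 (𝒳.act M X)).hom.1) := by
    have a₁ := (act_assoc u iM iX).hcomp (assoc_sq 𝒮 𝒳 (𝒮.one I) M X)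
    have g₁ : Sq ((u.act (iM.act iX)).comp (spanR 𝒳 (𝒮.one I) M X))
        (((u.act (.id (M.1 ⊙ₗ X.1))).comp (i₁.act ξ)).comp (𝒳.span (𝒮.one I) (𝒳.act M X)))
        (𝟙 _) (𝟙 _) :=
      ((Sq.act' (Sq.refl u) (id_act_id M.1 X.1)).hcomp₁ _).post (assoc' _ _ _)
    have g₂ : Sq (((u.act (.id (M.1 ⊙ₗ X.1))).comp (i₁.act ξ)).comp
        (𝒳.span (𝒮.one I) (𝒳.act M X))) ((i₀.act ξ).comp (spanU 𝒮 𝒳 (𝒳.act M X))) (𝟙 _) (𝟙 _) :=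
      ((act_interchange u ξ).hcomp₁ _).post (PSpan.assoc _ _ _)
    have a₂ := (id_unit_act (pM := pM) ξ).hcomp (unit_sq 𝒮 𝒳 (𝒳.act M X))
    exact ((a₁.post g₁).post g₂).trans (a₂.post (comp_id ξ))
  have B : Sq S₀ ξ ((λ_ M.1).hom ⊙ₗₘ 𝟙 X.1)
      (𝒳.map (unit 𝒮 (𝒮.mul J) M).hom (𝟙 X)).1 := by
    have g₁ : Sq S₀ (((spanU 𝒮 (𝒮.mul J) M).act iX).comp (𝒳.span _ X)) (𝟙 _) (𝟙 _) :=
      (assoc' _ _ _).post (((act_comp_act _ _ iX iX).post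
        (Sq.act' (Sq.refl _) (id_comp iX))).hcomp₁ _)
    have a₁ := ((unit_sq 𝒮 (𝒮.mul J) M).act (Sq.refl iX)).hcomp
      (𝒳.map_sq (unit 𝒮 (𝒮.mul J) M).hom (𝟙 X))
    exact g₁.pre (a₁.post (((id_act_id M.1 X.1).hcomp₁ _).post (id_comp _)))
  refine A.uniq_fiber' B ?_ (𝒳.mono _ _)
  rw [MonoidalLeftAction.actionHom_id]
  exact (MonoidalLeftAction.leftUnitor_actionHom _ _).symm

end MatAction

namespace MatSystem

lemma unitR_naturality {M M' : pM.Fiber (I ⊗ J)} (f : M ⟶ M') :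
    (𝒮.mul J).map f (𝟙 _) ≫ (𝒮.unitR M').hom = (𝒮.unitR M).hom ≫ f := by
  have h₁ := (((Sq.idSq f.1).act (Sq.refl (𝒮.oneSpan J))).hcomp
    ((𝒮.mul J).map_sq f (𝟙 (𝒮.one J)))).trans (𝒮.unitR_sq M')
  have h₂ := (𝒮.unitR_sq M).trans (Sq.idSq f.1)
  refine h₁.uniq_fiber' h₂ ?_ (inferInstanceAs (Mono (𝟙 _)))
  exact (congrArg (· ≫ _) (MonoidalCategory.tensorHom_id _ _)).trans
    (MonoidalCategory.rightUnitor_naturality _)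

end MatSystem

end Coherence
section Fibres

variable {ℐ : Type u₀} [Category.{v₀} ℐ] {𝓔 : Type u₁} [Category.{v₁} 𝓔] {p : 𝓔 ⥤ ℐ}
  [Bifibration p] {R S : ℐ}

/-- Reindexing `f^* X` of `X` along `f`. -/
noncomputable def pull (f : R ⟶ S) (X : p.Fiber S) : p.Fiber R :=
  ⟨(exists_isCart f X.2).choose,
    have := (exists_isCart f X.2).choose_spec.choose_spec
    IsHomLift.domain_eq p f (exists_isCart f X.2).choose_spec.choose⟩

/-- The chosen cartesian arrow `f^* X ⟶ X` over `f`. -/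
noncomputable def pullHom (f : R ⟶ S) (X : p.Fiber S) : (pull f X).1 ⟶ X.1 :=
  (exists_isCart f X.2).choose_spec.choose

instance pullHom_isCart (f : R ⟶ S) (X : p.Fiber S) : p.IsStronglyCartesian f (pullHom f X) :=
  (exists_isCart f X.2).choose_spec.choose_spec

lemma exists_isOpcart (f : R ⟶ S) (X : p.Fiber R) :
    ∃ (b : 𝓔) (φ : X.1 ⟶ b), p.IsStronglyCocartesian f φ := by
  obtain ⟨a, rfl⟩ := X
  exact Bifibration.exists_opcart f

/-- Pushforward `f^! X` (written `f_! X` by some authors) of `X` along `f`. -/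
noncomputable def push (f : R ⟶ S) (X : p.Fiber R) : p.Fiber S :=
  ⟨(exists_isOpcart f X).choose,
    have := (exists_isOpcart f X).choose_spec.choose_spec
    IsHomLift.codomain_eq p f (exists_isOpcart f X).choose_spec.choose⟩

/-- The chosen opcartesian arrow `X ⟶ f^! X` over `f`. -/
noncomputable def pushHom (f : R ⟶ S) (X : p.Fiber R) : X.1 ⟶ (push f X).1 :=
  (exists_isOpcart f X).choose_spec.choose

instance pushHom_isOpcart (f : R ⟶ S) (X : p.Fiber R) :
    p.IsStronglyCocartesian f (pushHom f X) :=
  (exists_isOpcart f X).choose_spec.choose_spec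

end Fibres

section MatrixProducts

variable {ℐ : Type u₀} [Category.{v₀} ℐ] [CartesianMonoidalCategory ℐ]
  {𝓜 : Type u₁} [Category.{v₁} 𝓜] [MonoidalCategory 𝓜] {pM : 𝓜 ⥤ ℐ} [MonoidalBifibration pM]
  {𝓔 : Type u₂} [Category.{v₂} 𝓔] [MonoidalLeftAction 𝓜 𝓔] {p : 𝓔 ⥤ ℐ} [Bifibration p]
  [Fibraction pM p] {I J K S : ℐ}

/-- The external action: `M • X` lies over `R ⊗ S` for `M` over `R` and `X` over `S`. -/
abbrev extAct {R S : ℐ} (M : pM.Fiber R) (X : p.Fiber S) : p.Fiber (R ⊗ S) :=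
  ⟨M.1 ⊙ₗ X.1, by rw [Fibraction.obj_act (pM := pM), M.2, X.2]⟩

/-- The action of the fibre `𝓜_S` on the fibre `𝓔_S`: restrict the external action along the
diagonal of `S`. -/
noncomputable abbrev fibAct (M : pM.Fiber S) (X : p.Fiber S) : p.Fiber S :=
  pull (lift (𝟙 S) (𝟙 S)) (extAct M X)

/-- Matrix-vector multiplication `π_I^! (M • π_J^* X)`. -/
noncomputable def matVec (M : pM.Fiber (I ⊗ J)) (X : p.Fiber J) : p.Fiber I :=
  push (fst I J) (fibAct M (pull (snd I J) X))

/-- Matrix multiplication: the pushforward along `I ⊗ J ⊗ K ⟶ I ⊗ K` of the restriction of the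
external product `M ⊗ N` along `(i, j, k) ↦ ((i, j), (j, k))`. -/
noncomputable def matMul (M : pM.Fiber (I ⊗ J)) (N : pM.Fiber (J ⊗ K)) : pM.Fiber (I ⊗ K) :=
  push (lift (fst (I ⊗ J) K ≫ fst I J) (snd (I ⊗ J) K))
    (pull (lift (fst (I ⊗ J) K) (lift (fst (I ⊗ J) K ≫ snd I J) (snd (I ⊗ J) K)))
      (extAct (p := pM) M N))

variable (pM) in
/-- The monoidal unit as an object of the fibre over the terminal object. -/
abbrev unitFib : pM.Fiber (𝟙_ ℐ) := ⟨𝟙_ 𝓜, MonoidalBifibration.obj_unit⟩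

variable (pM) in
/-- The identity matrix on `I`: restrict the monoidal unit to `I`, then push forward along the
diagonal of `I`. -/
noncomputable def matOne (I : ℐ) : pM.Fiber (I ⊗ I) :=
  push (lift (𝟙 I) (𝟙 I)) (pull (toUnit I) (unitFib pM))

lemma isHomLift_pull_act (M : pM.Fiber S) {T : ℐ} (f : S ⟶ T) (X : p.Fiber T) :
    p.IsHomLift (𝟙 S ⊗ₘ f) (𝟙 M.1 ⊙ₗₘ pullHom f X) :=
  isHomLift_act (IsHomLift.id M.2) inferInstance

lemma isCart_pull_act (M : pM.Fiber S) {T : ℐ} (f : S ⟶ T) (X : p.Fiber T) :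
    IsCart p (𝟙 M.1 ⊙ₗₘ pullHom f X) :=
  Fibraction.act_isCart (pM := pM) _ _ (IsCart.of_isIso _) (isCart_of (pullHom_isCart f X))

variable (pM p) in
/-- Matrix-vector multiplication, with the arrows exhibiting its universal property. -/
noncomputable def vecAction : MatAction pM p Frame.one where
  act M X := matVec M X
  span {I J} M X :=
    { Z := (fibAct M (pull (snd I J) X)).1
      c := pullHom _ (extAct M (pull (snd I J) X)) ≫ (𝟙 M.1 ⊙ₗₘ pullHom _ X)
      b := pushHom _ _
      cart := (isCart_of (pullHom_isCart _ _)).comp (isCart_pull_act M _ X)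
      opcart := isOpcart_of (pushHom_isOpcart _ _) }
  c_lift {I J} M X := by
    have h := isHomLift_pull_act M (snd I J) X
    have : p.IsHomLift (lift (𝟙 (I ⊗ J)) (𝟙 (I ⊗ J)) ≫ (𝟙 (I ⊗ J) ⊗ₘ snd I J))
      (pullHom (lift (𝟙 (I ⊗ J)) (𝟙 (I ⊗ J))) (extAct M (pull (snd I J) X)) ≫
        (𝟙 M.1 ⊙ₗₘ pullHom (snd I J) X)) := inferInstance
    have e : (Frame.one : Frame ℐ).d I J =
        lift (𝟙 (I ⊗ J)) (𝟙 (I ⊗ J)) ≫ (𝟙 (I ⊗ J) ⊗ₘ snd I J) := by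
      apply CartesianMonoidalCategory.hom_ext <;> simp [Frame.d, -id_tensorHom]
    rw [e]
    exact this
  b_lift {I J} M X := by
    have : p.IsHomLift (fst I J) (pushHom (fst I J) (fibAct M (pull (snd I J) X))) := inferInstance
    have e : (Frame.one : Frame ℐ).π I J = fst I J := Category.id_comp _
    rw [e]
    exact this

variable (pM) in
/-- Matrix multiplication and identity matrices, with the arrows exhibiting their universal
properties. -/
noncomputable def matSystem : MatSystem pM where
  mul _ :=
    { act M N := matMul M N
      span M N :=
        { Z := _
          c := pullHom _ (extAct (p := pM) M N)
          b := pushHom _ _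
          cart := isCart_of (pullHom_isCart _ _)
          opcart := isOpcart_of (pushHom_isOpcart _ _) }
      c_lift _ _ := (pullHom_isCart (p := pM) _ _).toIsHomLift
      b_lift _ _ := (pushHom_isOpcart (p := pM) _ _).toIsHomLift }
  one I := matOne pM I
  oneSpan I :=
    { Z := _
      c := pullHom (toUnit I) (unitFib pM)
      b := pushHom _ _
      cart := isCart_of (pullHom_isCart _ _)
      opcart := isOpcart_of (pushHom_isOpcart _ _) }
  one_c _ := (pullHom_isCart (p := pM) _ _).toIsHomLift
  one_b _ := (pushHom_isOpcart (p := pM) _ _).toIsHomLift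

end MatrixProducts
section Axioms

variable {ℐ : Type u₀} [Category.{v₀} ℐ] [CartesianMonoidalCategory ℐ]
  {𝓜 : Type u₁} [Category.{v₁} 𝓜] [MonoidalCategory 𝓜] {pM : 𝓜 ⥤ ℐ}
  {𝓔 : Type u₂} [Category.{v₂} 𝓔] [MonoidalLeftAction 𝓜 𝓔] {p : 𝓔 ⥤ ℐ}
  [Limits.HasPullbacks ℐ] [MonoidalBifibration pM] [BeckChevalley pM]
  [p.IsFibered] [BeckChevalley p] [Fibraction pM p]
  (𝒮 : MatSystem pM) {𝔉 : Frame ℐ} (𝒳 : MatAction pM p 𝔉) {I J K : ℐ}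

namespace MatAction

lemma map_comp_right (M : pM.Fiber (I ⊗ J)) {X X' X'' : p.Fiber (𝔉.A J)} (g : X ⟶ X')
    (g' : X' ⟶ X'') : 𝒳.map (𝟙 M) (g ≫ g') = 𝒳.map (𝟙 M) g ≫ 𝒳.map (𝟙 M) g' := by
  rw [← map_comp, Category.id_comp]

lemma map_comp_left {M M' M'' : pM.Fiber (I ⊗ J)} (f : M ⟶ M') (f' : M' ⟶ M'')
    (X : p.Fiber (𝔉.A J)) : 𝒳.map (f ≫ f') (𝟙 X) = 𝒳.map f (𝟙 X) ≫ 𝒳.map f' (𝟙 X) := by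
  rw [← map_comp, Category.id_comp]

lemma map_exchange {M M' : pM.Fiber (I ⊗ J)} {X X' : p.Fiber (𝔉.A J)} (f : M ⟶ M')
    (g : X ⟶ X') : 𝒳.map (𝟙 M) g ≫ 𝒳.map f (𝟙 X') = 𝒳.map f (𝟙 X) ≫ 𝒳.map (𝟙 M') g := by
  rw [← map_comp, ← map_comp]
  simp only [Category.id_comp, Category.comp_id]

lemma unit_conj {X X' : p.Fiber (𝔉.A I)} (h : X ⟶ X') :
    𝒳.map (𝟙 _) h = (unit 𝒮 𝒳 X).hom ≫ h ≫ (unit 𝒮 𝒳 X').inv := by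
  rw [← Category.assoc, Iso.eq_comp_inv, unit_naturality]

lemma assoc_conj_right (M : pM.Fiber (I ⊗ J)) (N : pM.Fiber (J ⊗ K)) {X X' : p.Fiber (𝔉.A K)}
    (h : X ⟶ X') : 𝒳.map (𝟙 ((𝒮.mul K).act M N)) h =
      (assoc 𝒮 𝒳 M N X).hom ≫ 𝒳.map (𝟙 M) (𝒳.map (𝟙 N) h) ≫ (assoc 𝒮 𝒳 M N X').inv := by
  rw [← Category.assoc, Iso.eq_comp_inv, ← assoc_naturality, map_id]

lemma assoc_conj_mid (M : pM.Fiber (I ⊗ J)) {N N' : pM.Fiber (J ⊗ K)} (g : N ⟶ N')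
    (X : p.Fiber (𝔉.A K)) : 𝒳.map ((𝒮.mul K).map (𝟙 M) g) (𝟙 X) =
      (assoc 𝒮 𝒳 M N X).hom ≫ 𝒳.map (𝟙 M) (𝒳.map g (𝟙 X)) ≫ (assoc 𝒮 𝒳 M N' X).inv := by
  rw [← Category.assoc, Iso.eq_comp_inv, ← assoc_naturality]

lemma assoc_conj_left {M M' : pM.Fiber (I ⊗ J)} (f : M ⟶ M') (N : pM.Fiber (J ⊗ K))
    (X : p.Fiber (𝔉.A K)) : 𝒳.map f (𝟙 (𝒳.act N X)) =
      (assoc 𝒮 𝒳 M N X).inv ≫ 𝒳.map ((𝒮.mul K).map f (𝟙 N)) (𝟙 X) ≫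
        (assoc 𝒮 𝒳 M' N X).hom := by
  rw [Iso.eq_inv_comp, assoc_naturality, map_id]

end MatAction

lemma MatSystem.unitR_conj {M M' : pM.Fiber (I ⊗ J)} (f : M ⟶ M') :
    (𝒮.mul J).map f (𝟙 _) = (𝒮.unitR M).hom ≫ f ≫ (𝒮.unitR M').inv := by
  rw [← Category.assoc, Iso.eq_comp_inv, unitR_naturality]

end Axioms

section MatBicategory

variable {ℐ : Type u₀} [Category.{v₀} ℐ] [CartesianMonoidalCategory ℐ]
  {𝓜 : Type u₁} [Category.{v₁} 𝓜] [MonoidalCategory 𝓜]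

/-- The objects of the bicategory of matrices: those of the base `ℐ`. -/
structure Mat (pM : 𝓜 ⥤ ℐ) where
  idx : ℐ

variable (pM : 𝓜 ⥤ ℐ) [Limits.HasPullbacks ℐ] [MonoidalBifibration pM] [BeckChevalley pM]

/-- 1-cells `I ⟶ J` are the objects of the fibre of `𝓜` over `I ⊗ J`. -/
noncomputable instance : CategoryStruct (Mat pM) where
  Hom I J := pM.Fiber (I.idx ⊗ J.idx)
  id I := matOne pM I.idx
  comp M N := matMul M N

/-- 2-cells are morphisms in the fibres. -/
noncomputable instance : Bicategory (Mat pM) where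
  homCategory I J := (inferInstance : Category (pM.Fiber (I.idx ⊗ J.idx)))
  whiskerLeft {a b c} (M : pM.Fiber (a.idx ⊗ b.idx)) (_ _ : pM.Fiber (b.idx ⊗ c.idx)) g :=
    ((matSystem pM).mul c.idx).map (𝟙 M) g
  whiskerRight {a b c} (_ _ : pM.Fiber (a.idx ⊗ b.idx)) f (N : pM.Fiber (b.idx ⊗ c.idx)) :=
    ((matSystem pM).mul c.idx).map f (𝟙 N)
  associator {_ _ _ d} M N P := ((matSystem pM).mul d.idx).assoc (matSystem pM) M N P
  leftUnitor {_ b} M := ((matSystem pM).mul b.idx).unit (matSystem pM) M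
  rightUnitor M := (matSystem pM).unitR M
  whiskerLeft_id {_ _ c} M N := ((matSystem pM).mul c.idx).map_id M N
  whiskerLeft_comp {_ _ c} M _ _ _ g g' := ((matSystem pM).mul c.idx).map_comp_right M g g'
  id_whiskerLeft {_ b} _ _ f := ((matSystem pM).mul b.idx).unit_conj (matSystem pM) f
  comp_whiskerLeft {_ _ _ d} M N _ _ f :=
    ((matSystem pM).mul d.idx).assoc_conj_right (matSystem pM) M N f
  id_whiskerRight {_ _ c} M N := ((matSystem pM).mul c.idx).map_id M N
  comp_whiskerRight {_ _ c} _ _ _ f f' N := ((matSystem pM).mul c.idx).map_comp_left f f' N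
  whiskerRight_id {_ _} _ _ f := (matSystem pM).unitR_conj f
  whiskerRight_comp {_ _ _ d} _ _ f N P :=
    ((matSystem pM).mul d.idx).assoc_conj_left (matSystem pM) f N P
  whisker_assoc {_ _ _ d} M _ _ f P :=
    ((matSystem pM).mul d.idx).assoc_conj_mid (matSystem pM) M f P
  whisker_exchange {_ _ c} _ _ _ _ f g := ((matSystem pM).mul c.idx).map_exchange f g
  pentagon {_ _ _ _ e} M N P Q :=
    (MatAction.pentagon (matSystem pM) ((matSystem pM).mul e.idx) M N P Q).symm
  triangle {_ _ c} M N := MatAction.triangle (matSystem pM) ((matSystem pM).mul c.idx) M N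

end MatBicategory
section MatMult

open Bicategory Opposite Bicategory.Opposite

variable {ℐ : Type u₀} [Category.{v₀} ℐ] [CartesianMonoidalCategory ℐ]
  {𝓜 : Type u₁} [Category.{v₁} 𝓜] [MonoidalCategory 𝓜]
  {𝓔 : Type u₂} [Category.{v₂} 𝓔] [MonoidalLeftAction 𝓜 𝓔]

section

variable {pM : 𝓜 ⥤ ℐ} {p : 𝓔 ⥤ ℐ}
  [Limits.HasPullbacks ℐ] [MonoidalBifibration pM] [BeckChevalley pM]
  [p.IsFibered] [BeckChevalley p] [Fibraction pM p]
  (𝒮 : MatSystem pM) {𝔉 : Frame ℐ} (𝒳 : MatAction pM p 𝔉) {I J K : ℐ}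

namespace MatAction

lemma assoc_conj_left' {M M' : pM.Fiber (I ⊗ J)} (f : M ⟶ M') (N : pM.Fiber (J ⊗ K))
    (X : p.Fiber (𝔉.A K)) : 𝒳.map ((𝒮.mul K).map f (𝟙 N)) (𝟙 X) =
      (assoc 𝒮 𝒳 M N X).hom ≫ 𝒳.map f (𝟙 (𝒳.act N X)) ≫ (assoc 𝒮 𝒳 M' N X).inv := by
  rw [← Category.assoc, Iso.eq_comp_inv, assoc_naturality, map_id]

lemma pentagon_inv (M : pM.Fiber (I ⊗ J)) (N : pM.Fiber (J ⊗ K)) {J' : ℐ}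
    (P : pM.Fiber (K ⊗ J')) (X : p.Fiber (𝔉.A J')) :
    𝒳.map (assoc 𝒮 (𝒮.mul J') M N P).inv (𝟙 X) =
      (assoc 𝒮 𝒳 M ((𝒮.mul J').act N P) X).hom ≫ 𝒳.map (𝟙 M) (assoc 𝒮 𝒳 N P X).hom ≫
        𝟙 _ ≫ (assoc 𝒮 𝒳 M N (𝒳.act P X)).inv ≫
          (assoc 𝒮 𝒳 ((𝒮.mul K).act M N) P X).inv := by
  have h : 𝒳.map (assoc 𝒮 (𝒮.mul J') M N P).hom (𝟙 X) ≫
      𝒳.map (assoc 𝒮 (𝒮.mul J') M N P).inv (𝟙 X) = 𝟙 _ := by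
    rw [← map_comp_left, Iso.hom_inv_id, map_id]
  have h' : 𝒳.map (assoc 𝒮 (𝒮.mul J') M N P).inv (𝟙 X) ≫
      𝒳.map (assoc 𝒮 (𝒮.mul J') M N P).hom (𝟙 X) = 𝟙 _ := by
    rw [← map_comp_left, Iso.inv_hom_id, map_id]
  have := pentagon 𝒮 𝒳 M N P X
  rw [Category.id_comp, ← Category.assoc, ← Category.assoc, Iso.eq_comp_inv, Iso.eq_comp_inv,
    Category.assoc, this, reassoc_of% h']

end MatAction

end

variable (pM : 𝓜 ⥤ ℐ) (p : 𝓔 ⥤ ℐ)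
  [Limits.HasPullbacks ℐ] [MonoidalBifibration pM] [BeckChevalley pM]
  [Bifibration p] [BeckChevalley p] [Fibraction pM p]

/-- The functor `π_I^! (M • π_J^* (-))`. -/
noncomputable def matVecFunctor {I J : ℐ} (M : pM.Fiber (I ⊗ J)) : p.Fiber J ⥤ p.Fiber I where
  obj X := matVec M X
  map g := (vecAction pM p).map (𝟙 M) g
  map_id X := (vecAction pM p).map_id M X
  map_comp g g' := (vecAction pM p).map_comp_right M g g'

/-- The indexed category `I ↦ 𝓔_I`, `M ↦ π_I^! (M • π_J^* (-))`. -/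
noncomputable def MatMult : (Mat pM)ᵒᵖ ⥤ᵖ Cat.{v₂, u₂} where
  obj I := Cat.of (p.Fiber I.unop.idx)
  map M := (matVecFunctor pM p M.unop).toCatHom
  map₂ {J I M N} f := NatTrans.toCatHom₂
    { app X := (vecAction pM p).map (I := I.unop.idx) (J := J.unop.idx) f.unop2 (𝟙 X)
      naturality X Y g := (vecAction pM p).map_exchange (I := I.unop.idx) (J := J.unop.idx)
        f.unop2 g }
  map₂_id {J I} M := by
    ext X
    exact (vecAction pM p).map_id (I := I.unop.idx) (J := J.unop.idx) M.unop X
  map₂_comp {J I _ _ _} f f' := by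
    ext X
    exact (vecAction pM p).map_comp_left (I := I.unop.idx) (J := J.unop.idx) f.unop2 f'.unop2 X
  mapId I := Cat.Hom.isoMk (NatIso.ofComponents
    (fun X => (vecAction pM p).unit (I := I.unop.idx) (matSystem pM) X)
    (fun g => (vecAction pM p).unit_naturality (I := I.unop.idx) (matSystem pM) g))
  mapComp {K J I} N M := Cat.Hom.isoMk (NatIso.ofComponents
    (fun X => (vecAction pM p).assoc (I := I.unop.idx) (J := J.unop.idx) (K := K.unop.idx)
      (matSystem pM) M.unop N.unop X)
    (fun g => by
      have := (vecAction pM p).assoc_naturality (I := I.unop.idx) (J := J.unop.idx)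
        (K := K.unop.idx) (matSystem pM) (𝟙 M.unop) (𝟙 N.unop) g
      rw [MatAction.map_id] at this
      exact this))
  map₂_whisker_left {K J I} N _ _ f := by
    ext X
    exact (vecAction pM p).assoc_conj_left' (I := I.unop.idx) (J := J.unop.idx)
      (K := K.unop.idx) (matSystem pM) f.unop2 N.unop X
  map₂_whisker_right {K J I _ _} f M := by
    ext X
    exact (vecAction pM p).assoc_conj_mid (I := I.unop.idx) (J := J.unop.idx)
      (K := K.unop.idx) (matSystem pM) M.unop f.unop2 X
  map₂_associator {L K J I} P N M := by
    ext X
    exact (vecAction pM p).pentagon_inv (I := I.unop.idx) (J := J.unop.idx)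
      (K := K.unop.idx) (J' := L.unop.idx) (matSystem pM) M.unop N.unop P.unop X
  map₂_left_unitor {J I} M := by
    ext X
    refine ((vecAction pM p).triangle (I := I.unop.idx) (J := J.unop.idx) 
      (matSystem pM) M.unop X).symm.trans ?_
    exact congrArg (_ ≫ ·) (Category.comp_id _).symm
  map₂_right_unitor {J I} M := by
    ext X
    refine ((vecAction pM p).assoc_one (I := I.unop.idx) (J := J.unop.idx) 
      (matSystem pM) M.unop X).symm.trans ?_
    exact congrArg (_ ≫ ·) (Category.comp_id _).symm

end MatMult
section Total

open Bicategory

universe w v u x y x' y'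

/-- Data over a bicategory `B` whose total bicategory is locally faithful over `B`: objects over
the objects of `B`, 1-cells over the 1-cells of `B`, and the property of a 2-cell of `B` of lifting
to a 2-cell between given 1-cells. -/
structure Displayed (B : Type u) [Bicategory.{w, v} B] where
  Ob : B → Type x
  Hm {a b : B} (f : a ⟶ b) (X : Ob a) (Y : Ob b) : Type y
  Rel {a b : B} {f g : a ⟶ b} (α : f ⟶ g) {X : Ob a} {Y : Ob b} (φ : Hm f X Y) (ψ : Hm g X Y) : Prop
  id {a : B} (X : Ob a) : Hm (𝟙 a) X X
  comp {a b c : B} {f : a ⟶ b} {g : b ⟶ c} {X : Ob a} {Y : Ob b} {Z : Ob c} (φ : Hm f X Y)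
    (ψ : Hm g Y Z) : Hm (f ≫ g) X Z
  rel_id {a b : B} {f : a ⟶ b} {X : Ob a} {Y : Ob b} (φ : Hm f X Y) : Rel (𝟙 f) φ φ
  rel_comp {a b : B} {f g h : a ⟶ b} {α : f ⟶ g} {β : g ⟶ h} {X : Ob a} {Y : Ob b}
    {φ : Hm f X Y} {ψ : Hm g X Y} {χ : Hm h X Y} : Rel α φ ψ → Rel β ψ χ → Rel (α ≫ β) φ χ
  rel_whiskerLeft {a b c : B} {f : a ⟶ b} {g h : b ⟶ c} {α : g ⟶ h} {X : Ob a} {Y : Ob b}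
    {Z : Ob c} (φ : Hm f X Y) {ψ : Hm g Y Z} {χ : Hm h Y Z} :
    Rel α ψ χ → Rel (f ◁ α) (comp φ ψ) (comp φ χ)
  rel_whiskerRight {a b c : B} {f g : a ⟶ b} {h : b ⟶ c} {α : f ⟶ g} {X : Ob a} {Y : Ob b}
    {Z : Ob c} {φ : Hm f X Y} {ψ : Hm g X Y} (χ : Hm h Y Z) :
    Rel α φ ψ → Rel (α ▷ h) (comp φ χ) (comp ψ χ)
  rel_associator {a b c d : B} {f : a ⟶ b} {g : b ⟶ c} {h : c ⟶ d} {X : Ob a} {Y : Ob b}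
    {Z : Ob c} {W : Ob d} (φ : Hm f X Y) (ψ : Hm g Y Z) (χ : Hm h Z W) :
    Rel (Bicategory.associator f g h).hom (comp (comp φ ψ) χ) (comp φ (comp ψ χ)) ∧
      Rel (Bicategory.associator f g h).inv (comp φ (comp ψ χ)) (comp (comp φ ψ) χ)
  rel_leftUnitor {a b : B} {f : a ⟶ b} {X : Ob a} {Y : Ob b} (φ : Hm f X Y) :
    Rel (Bicategory.leftUnitor f).hom (comp (id X) φ) φ ∧ Rel (Bicategory.leftUnitor f).inv φ (comp (id X) φ)
  rel_rightUnitor {a b : B} {f : a ⟶ b} {X : Ob a} {Y : Ob b} (φ : Hm f X Y) :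
    Rel (Bicategory.rightUnitor f).hom (comp φ (id Y)) φ ∧ Rel (Bicategory.rightUnitor f).inv φ (comp φ (id Y))

variable {B : Type u} [Bicategory.{w, v} B]

namespace Displayed

/-- Objects of the total bicategory. -/
structure Total (𝒟 : Displayed.{w, v, u, x, y} B) where
  base : B
  fib : 𝒟.Ob base

/-- 1-cells of the total bicategory. -/
structure Hom₁ {𝒟 : Displayed.{w, v, u, x, y} B} (a b : 𝒟.Total) where
  base : a.base ⟶ b.base
  fib : 𝒟.Hm base a.fib b.fib

variable {𝒟 : Displayed.{w, v, u, x, y} B}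

instance : CategoryStruct 𝒟.Total where
  Hom a b := Hom₁ a b
  id a := ⟨𝟙 a.base, 𝒟.id a.fib⟩
  comp f g := ⟨f.base ≫ g.base, 𝒟.comp f.fib g.fib⟩

/-- 2-cells of the total bicategory. -/
@[ext] structure Hom₂ {a b : 𝒟.Total} (f g : a ⟶ b) where
  base : f.base ⟶ g.base
  rel : 𝒟.Rel base f.fib g.fib

instance (a b : 𝒟.Total) : Category (a ⟶ b) where
  Hom f g := Hom₂ f g
  id f := ⟨𝟙 f.base, 𝒟.rel_id f.fib⟩
  comp α β := ⟨α.base ≫ β.base, 𝒟.rel_comp α.rel β.rel⟩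
  id_comp _ := Hom₂.ext (Category.id_comp _)
  comp_id _ := Hom₂.ext (Category.comp_id _)
  assoc _ _ _ := Hom₂.ext (Category.assoc _ _ _)

/-- An invertible 2-cell of the total bicategory. -/
@[simps] def isoMk {a b : 𝒟.Total} {f g : a ⟶ b} (e : f.base ≅ g.base)
    (h : 𝒟.Rel e.hom f.fib g.fib ∧ 𝒟.Rel e.inv g.fib f.fib) : f ≅ g where
  hom := ⟨e.hom, h.1⟩
  inv := ⟨e.inv, h.2⟩
  hom_inv_id := Hom₂.ext e.hom_inv_id
  inv_hom_id := Hom₂.ext e.inv_hom_id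

instance : Bicategory 𝒟.Total where
  homCategory _ _ := inferInstance
  whiskerLeft f _ _ α := Hom₂.mk (f.base ◁ Hom₂.base α) (𝒟.rel_whiskerLeft f.fib (Hom₂.rel α))
  whiskerRight α h := Hom₂.mk (Hom₂.base α ▷ h.base) (𝒟.rel_whiskerRight h.fib (Hom₂.rel α))
  associator f g h :=
    isoMk (Bicategory.associator f.base g.base h.base) (𝒟.rel_associator f.fib g.fib h.fib)
  leftUnitor f := isoMk (Bicategory.leftUnitor f.base) (𝒟.rel_leftUnitor f.fib)
  rightUnitor f := isoMk (Bicategory.rightUnitor f.base) (𝒟.rel_rightUnitor f.fib)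
  whiskerLeft_id _ _ := Hom₂.ext (Bicategory.whiskerLeft_id _ _)
  whiskerLeft_comp _ _ _ _ _ _ := Hom₂.ext (Bicategory.whiskerLeft_comp _ _ _)
  id_whiskerLeft _ := Hom₂.ext (Bicategory.id_whiskerLeft _)
  comp_whiskerLeft _ _ _ _ _ := Hom₂.ext (Bicategory.comp_whiskerLeft _ _ _)
  id_whiskerRight _ _ := Hom₂.ext (Bicategory.id_whiskerRight _ _)
  comp_whiskerRight _ _ _ := Hom₂.ext (Bicategory.comp_whiskerRight _ _ _)
  whiskerRight_id _ := Hom₂.ext (Bicategory.whiskerRight_id _)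
  whiskerRight_comp _ _ _ := Hom₂.ext (Bicategory.whiskerRight_comp _ _ _)
  whisker_assoc _ _ _ _ _ := Hom₂.ext (Bicategory.whisker_assoc _ _ _)
  whisker_exchange _ _ := Hom₂.ext (Bicategory.whisker_exchange _ _)
  pentagon _ _ _ _ := Hom₂.ext (Bicategory.pentagon _ _ _ _)
  triangle _ _ := Hom₂.ext (Bicategory.triangle _ _)

lemma strict_aux {a b : B} {f g : a ⟶ b} (α : f ⟶ g) : α = 𝟙 f ≫ α ≫ 𝟙 g := by simp

lemma strict_aux_assoc {a b c d : B} (f : a ⟶ b) (g : b ⟶ c) (h : c ⟶ d) :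
    (Bicategory.associator f g h).hom = 𝟙 ((f ≫ g) ≫ h) ≫ 𝟙 (f ≫ g) ▷ h ≫
      (Bicategory.associator f g h).hom ≫ f ◁ 𝟙 (g ≫ h) ≫ 𝟙 (f ≫ g ≫ h) := by simp

lemma strict_aux_left {a b : B} (f : a ⟶ b) : (Bicategory.leftUnitor f).hom =
    𝟙 (𝟙 a ≫ f) ≫ 𝟙 (𝟙 a) ▷ f ≫ (Bicategory.leftUnitor f).hom := by simp

lemma strict_aux_right {a b : B} (f : a ⟶ b) : (Bicategory.rightUnitor f).hom =
    𝟙 (f ≫ 𝟙 b) ≫ f ◁ 𝟙 (𝟙 b) ≫ (Bicategory.rightUnitor f).hom := by simp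

variable (𝒟)

/-- The projection from the total bicategory. -/
def proj : 𝒟.Total ⥤ᵖ B where
  obj a := a.base
  map f := Hom₁.base f
  map₂ α := Hom₂.base α
  map₂_id _ := rfl
  map₂_comp _ _ := rfl
  mapId _ := Iso.refl _
  mapComp _ _ := Iso.refl _
  map₂_whisker_left _ _ _ _ := strict_aux _
  map₂_whisker_right _ _ := strict_aux _
  map₂_associator _ _ _ := strict_aux_assoc _ _ _
  map₂_left_unitor _ := strict_aux_left _
  map₂_right_unitor _ := strict_aux_right _

/-- The fibre product over `B` of two total bicategories, as displayed data. -/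
def prod (𝒟 : Displayed.{w, v, u, x, y} B) (𝒟' : Displayed.{w, v, u, x', y'} B) :
    Displayed.{w, v, u, max x x', max y y'} B where
  Ob a := 𝒟.Ob a × 𝒟'.Ob a
  Hm f X Y := 𝒟.Hm f X.1 Y.1 × 𝒟'.Hm f X.2 Y.2
  Rel {_ _ _ _} α {_ _} φ ψ := 𝒟.Rel α φ.1 ψ.1 ∧ 𝒟'.Rel α φ.2 ψ.2
  id X := (𝒟.id X.1, 𝒟'.id X.2)
  comp φ ψ := (𝒟.comp φ.1 ψ.1, 𝒟'.comp φ.2 ψ.2)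
  rel_id φ := ⟨𝒟.rel_id φ.1, 𝒟'.rel_id φ.2⟩
  rel_comp h h' := ⟨𝒟.rel_comp h.1 h'.1, 𝒟'.rel_comp h.2 h'.2⟩
  rel_whiskerLeft φ _ _ h := ⟨𝒟.rel_whiskerLeft φ.1 h.1, 𝒟'.rel_whiskerLeft φ.2 h.2⟩
  rel_whiskerRight χ h := ⟨𝒟.rel_whiskerRight χ.1 h.1, 𝒟'.rel_whiskerRight χ.2 h.2⟩
  rel_associator φ ψ χ :=
    ⟨⟨(𝒟.rel_associator φ.1 ψ.1 χ.1).1, (𝒟'.rel_associator φ.2 ψ.2 χ.2).1⟩,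
      ⟨(𝒟.rel_associator φ.1 ψ.1 χ.1).2, (𝒟'.rel_associator φ.2 ψ.2 χ.2).2⟩⟩
  rel_leftUnitor φ := ⟨⟨(𝒟.rel_leftUnitor φ.1).1, (𝒟'.rel_leftUnitor φ.2).1⟩,
    ⟨(𝒟.rel_leftUnitor φ.1).2, (𝒟'.rel_leftUnitor φ.2).2⟩⟩
  rel_rightUnitor φ := ⟨⟨(𝒟.rel_rightUnitor φ.1).1, (𝒟'.rel_rightUnitor φ.2).1⟩,
    ⟨(𝒟.rel_rightUnitor φ.1).2, (𝒟'.rel_rightUnitor φ.2).2⟩⟩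

/-- The first projection of a fibre product. -/
def prodFst (𝒟' : Displayed.{w, v, u, x', y'} B) : (𝒟.prod 𝒟').Total ⥤ᵖ 𝒟.Total where
  obj a := ⟨a.base, a.fib.1⟩
  map f := Hom₁.mk (Hom₁.base (𝒟 := 𝒟.prod 𝒟') f) (Hom₁.fib (𝒟 := 𝒟.prod 𝒟') f).1
  map₂ α :=
    Hom₂.mk (Hom₂.base (𝒟 := 𝒟.prod 𝒟') α) (Hom₂.rel (𝒟 := 𝒟.prod 𝒟') α).1
  map₂_id _ := rfl
  map₂_comp _ _ := rfl
  mapId _ := Iso.refl _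
  mapComp _ _ := Iso.refl _
  map₂_whisker_left _ _ _ _ := Hom₂.ext (strict_aux (B := B) _)
  map₂_whisker_right _ _ := Hom₂.ext (strict_aux (B := B) _)
  map₂_associator _ _ _ := Hom₂.ext (strict_aux_assoc (B := B) _ _ _)
  map₂_left_unitor _ := Hom₂.ext (strict_aux_left (B := B) _)
  map₂_right_unitor _ := Hom₂.ext (strict_aux_right (B := B) _)

/-- The second projection of a fibre product. -/
def prodSnd (𝒟' : Displayed.{w, v, u, x', y'} B) : (𝒟.prod 𝒟').Total ⥤ᵖ 𝒟'.Total where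
  obj a := ⟨a.base, a.fib.2⟩
  map f := Hom₁.mk (Hom₁.base (𝒟 := 𝒟.prod 𝒟') f) (Hom₁.fib (𝒟 := 𝒟.prod 𝒟') f).2
  map₂ α :=
    Hom₂.mk (Hom₂.base (𝒟 := 𝒟.prod 𝒟') α) (Hom₂.rel (𝒟 := 𝒟.prod 𝒟') α).2
  map₂_id _ := rfl
  map₂_comp _ _ := rfl
  mapId _ := Iso.refl _
  mapComp _ _ := Iso.refl _
  map₂_whisker_left _ _ _ _ := Hom₂.ext (strict_aux (B := B) _)
  map₂_whisker_right _ _ := Hom₂.ext (strict_aux (B := B) _)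
  map₂_associator _ _ _ := Hom₂.ext (strict_aux_assoc (B := B) _ _ _)
  map₂_left_unitor _ := Hom₂.ext (strict_aux_left (B := B) _)
  map₂_right_unitor _ := Hom₂.ext (strict_aux_right (B := B) _)

end Displayed

end Total
section Grothendieck

open Bicategory Opposite Bicategory.Opposite

universe w v u vc uc vd ud

variable {B : Type u} [Bicategory.{w, v} B]

section

variable (F : Bᵒᵖ ⥤ᵖ Cat.{vc, uc})

/-- The functor `F f : F b ⥤ F a` for a 1-cell `f : a ⟶ b`. -/
abbrev idxFunctor {a b : B} (f : a ⟶ b) : F.obj (op b) ⥤ F.obj (op a) := (F.map f.op).toFunctor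

/-- The transformation `F f ⟶ F g` for a 2-cell `f ⟶ g`. -/
abbrev idxTrans {a b : B} {f g : a ⟶ b} (α : f ⟶ g) : idxFunctor F f ⟶ idxFunctor F g :=
  (F.map₂ (op2 α)).toNatTrans

/-- The coherence isomorphism `F (f ≫ g) ≅ F f ∘ F g`. -/
abbrev idxComp {a b c : B} (f : a ⟶ b) (g : b ⟶ c) :
    idxFunctor F (f ≫ g) ≅ idxFunctor F g ⋙ idxFunctor F f :=
  Cat.Hom.toNatIso (F.mapComp g.op f.op)

/-- The coherence isomorphism `F (𝟙 a) ≅ 𝟭`. -/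
abbrev idxId (a : B) : idxFunctor F (𝟙 a) ≅ 𝟭 (F.obj (op a)) :=
  Cat.Hom.toNatIso (F.mapId (op a))

lemma idxTrans_id {a b : B} (f : a ⟶ b) (X) : (idxTrans F (𝟙 f)).app X = 𝟙 _ :=
  congr((Cat.Hom₂.toNatTrans $(F.map₂_id f.op)).app X)

lemma idxTrans_comp {a b : B} {f g h : a ⟶ b} (α : f ⟶ g) (β : g ⟶ h) (X) :
    (idxTrans F (α ≫ β)).app X = (idxTrans F α).app X ≫ (idxTrans F β).app X :=
  congr((Cat.Hom₂.toNatTrans $(F.map₂_comp (op2 α) (op2 β))).app X)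

lemma idxTrans_whiskerLeft {a b c : B} (f : a ⟶ b) {g h : b ⟶ c} (α : g ⟶ h) (X) :
    (idxTrans F (f ◁ α)).app X = (idxComp F f g).hom.app X ≫
      (idxFunctor F f).map ((idxTrans F α).app X) ≫ (idxComp F f h).inv.app X :=
  congr((Cat.Hom₂.toNatTrans $(F.map₂_whisker_right (op2 α) f.op)).app X)

lemma idxTrans_whiskerRight {a b c : B} {f g : a ⟶ b} (α : f ⟶ g) (h : b ⟶ c) (X) :
    (idxTrans F (α ▷ h)).app X = (idxComp F f h).hom.app X ≫
      (idxTrans F α).app ((idxFunctor F h).obj X) ≫ (idxComp F g h).inv.app X :=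
  congr((Cat.Hom₂.toNatTrans $(F.map₂_whisker_left h.op (op2 α))).app X)

lemma idxTrans_assoc_inv {a b c d : B} (f : a ⟶ b) (g : b ⟶ c) (h : c ⟶ d) (X) :
    (idxTrans F (Bicategory.associator f g h).inv).app X = (idxComp F f (g ≫ h)).hom.app X ≫
      (idxFunctor F f).map ((idxComp F g h).hom.app X) ≫
        (idxComp F f g).inv.app ((idxFunctor F h).obj X) ≫ (idxComp F (f ≫ g) h).inv.app X := by
  have := congr((Cat.Hom₂.toNatTrans $(F.map₂_associator h.op g.op f.op)).app X)
  refine this.trans ?_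
  refine congrArg (_ ≫ ·) (congrArg (_ ≫ ·) ?_)
  exact Category.id_comp _

lemma idxTrans_leftUnitor {a b : B} (f : a ⟶ b) (X) :
    (idxTrans F (Bicategory.leftUnitor f).hom).app X =
      (idxComp F (𝟙 a) f).hom.app X ≫ (idxId F a).hom.app ((idxFunctor F f).obj X) := by
  have := congr((Cat.Hom₂.toNatTrans $(F.map₂_right_unitor f.op)).app X)
  refine this.trans (congrArg (_ ≫ ·) ?_)
  exact Category.comp_id _

lemma idxTrans_rightUnitor {a b : B} (f : a ⟶ b) (X) :
    (idxTrans F (Bicategory.rightUnitor f).hom).app X =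
      (idxComp F f (𝟙 b)).hom.app X ≫ (idxFunctor F f).map ((idxId F b).hom.app X) := by
  have := congr((Cat.Hom₂.toNatTrans $(F.map₂_left_unitor f.op)).app X)
  refine this.trans (congrArg (_ ≫ ·) ?_)
  exact Category.comp_id _

lemma idxTrans_hom_inv {a b : B} {f g : a ⟶ b} (e : f ≅ g) (X) :
    (idxTrans F e.hom).app X ≫ (idxTrans F e.inv).app X = 𝟙 _ := by
  rw [← idxTrans_comp, e.hom_inv_id, idxTrans_id]

lemma idxTrans_inv_hom {a b : B} {f g : a ⟶ b} (e : f ≅ g) (X) :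
    (idxTrans F e.inv).app X ≫ (idxTrans F e.hom).app X = 𝟙 _ := by
  rw [← idxTrans_comp, e.inv_hom_id, idxTrans_id]

lemma idxComp_inv_hom {a b c : B} (f : a ⟶ b) (g : b ⟶ c) (X) {Z} (h : _ ⟶ Z) :
    (idxComp F f g).inv.app X ≫ (idxComp F f g).hom.app X ≫ h = h :=
  Iso.inv_hom_id_app_assoc _ _ _

lemma idxComp_hom_inv {a b c : B} (f : a ⟶ b) (g : b ⟶ c) (X) {Z} (h : _ ⟶ Z) :
    (idxComp F f g).hom.app X ≫ (idxComp F f g).inv.app X ≫ h = h :=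
  Iso.hom_inv_id_app_assoc _ _ _

lemma idxComp_inv_nat {a b c : B} (f : a ⟶ b) (g : b ⟶ c) {X Y} (k : X ⟶ Y) {Z} (h : _ ⟶ Z) :
    (idxFunctor F f).map ((idxFunctor F g).map k) ≫ (idxComp F f g).inv.app Y ≫ h =
      (idxComp F f g).inv.app X ≫ (idxFunctor F (f ≫ g)).map k ≫ h :=
  NatTrans.naturality_assoc (idxComp F f g).inv k h

lemma idxComp_hom_nat {a b c : B} (f : a ⟶ b) (g : b ⟶ c) {X Y} (k : X ⟶ Y) {Z} (h : _ ⟶ Z) :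
    (idxFunctor F (f ≫ g)).map k ≫ (idxComp F f g).hom.app Y ≫ h =
      (idxComp F f g).hom.app X ≫ (idxFunctor F f).map ((idxFunctor F g).map k) ≫ h :=
  NatTrans.naturality_assoc (idxComp F f g).hom k h

/-- The Grothendieck construction of an indexed category over a bicategory: a 1-cell
`(a, X) ⟶ (b, Y)` over `f : a ⟶ b` is a morphism `X ⟶ F f Y`, and a 2-cell `φ ⟶ ψ` over
`α : f ⟶ g` is a proof that `φ ≫ F α Y = ψ`. -/
def groth : Displayed.{w, v, u, uc, vc} B where
  Ob a := F.obj (op a)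
  Hm f X Y := X ⟶ (idxFunctor F f).obj Y
  Rel {_ _ _ _} α {_ Y} φ ψ := φ ≫ (idxTrans F α).app Y = ψ
  id {a} X := (idxId F a).inv.app X
  comp {_ _ _ f g _ _ Z} φ ψ := φ ≫ (idxFunctor F f).map ψ ≫ (idxComp F f g).inv.app Z
  rel_id φ := by rw [idxTrans_id, Category.comp_id]
  rel_comp h h' := by rw [idxTrans_comp, reassoc_of% h, h']
  rel_whiskerLeft φ ψ χ h := by
    subst h
    rw [idxTrans_whiskerLeft]
    simp only [Category.assoc, idxComp_inv_hom, Functor.map_comp]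
  rel_whiskerRight {_ _ _ _ _ _ α _ _ _} φ ψ χ h := by
    subst h
    rw [idxTrans_whiskerRight]
    simp only [Category.assoc, idxComp_inv_hom]
    rw [(idxTrans F α).naturality_assoc]
  rel_associator {_ _ _ _ f g h _ _ _ W} φ ψ χ := by
    have e : (φ ≫ (idxFunctor F f).map (ψ ≫ (idxFunctor F g).map χ ≫ (idxComp F g h).inv.app W) ≫
        (idxComp F f (g ≫ h)).inv.app W) ≫ (idxTrans F (Bicategory.associator f g h).inv).app W =
        (φ ≫ (idxFunctor F f).map ψ ≫ (idxComp F f g).inv.app _) ≫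
          (idxFunctor F (f ≫ g)).map χ ≫ (idxComp F (f ≫ g) h).inv.app W := by
      rw [idxTrans_assoc_inv]
      simp only [Category.assoc, idxComp_inv_hom, Functor.map_comp]
      rw [← Functor.map_comp_assoc _ ((idxComp F g h).inv.app W), Iso.inv_hom_id_app,
        CategoryTheory.Functor.map_id, Category.id_comp, idxComp_inv_nat]
    refine ⟨?_, e⟩
    rw [← e, Category.assoc, idxTrans_inv_hom, Category.comp_id]
  rel_leftUnitor {a _ f X Y} φ := by
    have e : ((idxId F a).inv.app X ≫ (idxFunctor F (𝟙 a)).map φ ≫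
        (idxComp F (𝟙 a) f).inv.app Y) ≫ (idxTrans F (Bicategory.leftUnitor f).hom).app Y = φ := by
      rw [idxTrans_leftUnitor]
      simp only [Category.assoc, idxComp_inv_hom]
      rw [(idxId F a).hom.naturality φ, Iso.inv_hom_id_app_assoc, CategoryTheory.Functor.id_map]
    refine ⟨e, ?_⟩
    nth_rw 1 [← e]
    rw [Category.assoc, idxTrans_hom_inv, Category.comp_id]
  rel_rightUnitor {_ b f X Y} φ := by
    have e : (φ ≫ (idxFunctor F f).map ((idxId F b).inv.app Y) ≫
        (idxComp F f (𝟙 b)).inv.app Y) ≫ (idxTrans F (Bicategory.rightUnitor f).hom).app Y =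
        φ := by
      rw [idxTrans_rightUnitor]
      simp only [Category.assoc, idxComp_inv_hom]
      rw [← Functor.map_comp, Iso.inv_hom_id_app]
      exact (congrArg (φ ≫ ·) ((idxFunctor F f).map_id Y)).trans (Category.comp_id φ)
    refine ⟨e, ?_⟩
    nth_rw 1 [← e]
    rw [Category.assoc, idxTrans_hom_inv, Category.comp_id]

/-- The Grothendieck construction of the fibrewise opposite `a ↦ (F a)ᵒᵖ` of an indexed category:
a 1-cell `(a, X) ⟶ (b, Y)` over `f : a ⟶ b` is a morphism `F f Y ⟶ X`, and a 2-cell `φ ⟶ ψ` over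
`α : f ⟶ g` is a proof that `F α Y ≫ ψ = φ`. -/
def grothOp : Displayed.{w, v, u, uc, vc} B where
  Ob a := F.obj (op a)
  Hm f X Y := (idxFunctor F f).obj Y ⟶ X
  Rel {_ _ _ _} α {_ Y} φ ψ := (idxTrans F α).app Y ≫ ψ = φ
  id {a} X := (idxId F a).hom.app X
  comp {_ _ _ f g _ _ Z} φ ψ := (idxComp F f g).hom.app Z ≫ (idxFunctor F f).map ψ ≫ φ
  rel_id φ := by rw [idxTrans_id, Category.id_comp]
  rel_comp h h' := by rw [idxTrans_comp, Category.assoc, h', h]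
  rel_whiskerLeft φ ψ χ h := by
    subst h
    rw [idxTrans_whiskerLeft]
    simp only [Category.assoc, idxComp_inv_hom, Functor.map_comp]
  rel_whiskerRight {_ _ _ _ _ _ α _ _ _} φ ψ χ h := by
    subst h
    rw [idxTrans_whiskerRight]
    simp only [Category.assoc, idxComp_inv_hom]
    rw [(idxTrans F α).naturality_assoc]
  rel_associator {_ _ _ _ f g h _ _ _ W} φ ψ χ := by
    have e : (idxTrans F (Bicategory.associator f g h).inv).app W ≫
        (idxComp F (f ≫ g) h).hom.app W ≫ (idxFunctor F (f ≫ g)).map χ ≫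
          (idxComp F f g).hom.app _ ≫ (idxFunctor F f).map ψ ≫ φ =
        (idxComp F f (g ≫ h)).hom.app W ≫ (idxFunctor F f).map ((idxComp F g h).hom.app W ≫
          (idxFunctor F g).map χ ≫ ψ) ≫ φ := by
      rw [idxTrans_assoc_inv]
      simp only [Category.assoc, idxComp_inv_hom, Functor.map_comp]
      rw [idxComp_hom_nat, idxComp_inv_hom]
    refine ⟨?_, e⟩
    rw [← e, ← Category.assoc, idxTrans_hom_inv, Category.id_comp]
  rel_leftUnitor {a _ f X Y} φ := by
    have e : (idxTrans F (Bicategory.leftUnitor f).hom).app Y ≫ φ =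
        (idxComp F (𝟙 a) f).hom.app Y ≫ (idxFunctor F (𝟙 a)).map φ ≫ (idxId F a).hom.app X := by
      rw [idxTrans_leftUnitor, (idxId F a).hom.naturality φ, Category.assoc, CategoryTheory.Functor.id_map]
    refine ⟨e, ?_⟩
    rw [← e, ← Category.assoc, idxTrans_inv_hom, Category.id_comp]
  rel_rightUnitor {_ b f X Y} φ := by
    have e : (idxTrans F (Bicategory.rightUnitor f).hom).app Y ≫ φ =
        (idxComp F f (𝟙 b)).hom.app Y ≫ (idxFunctor F f).map ((idxId F b).hom.app Y) ≫ φ := by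
      rw [idxTrans_rightUnitor, Category.assoc]
    refine ⟨e, ?_⟩
    rw [← e, ← Category.assoc, idxTrans_inv_hom, Category.id_comp]

end

end Grothendieck
section LocalQuotient

open Bicategory

universe w v u

/-- The category obtained from a bicategory by replacing its categories of 1-cells with their sets
of connected components. -/
structure LocalPi₀ (B : Type u) [Bicategory.{w, v} B] where
  of : B

variable {B : Type u} [Bicategory.{w, v} B]

/-- Composition of connected components. -/
def compPi₀ {a b c : B} (f : ConnectedComponents (a ⟶ b)) (g : ConnectedComponents (b ⟶ c)) :
    ConnectedComponents (a ⟶ c) :=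
  Quotient.map₂ (fun f g => f ≫ g) (fun _ _ h _ _ k =>
    (zigzag_obj_of_zigzag (postcomp a _) h).trans (zigzag_obj_of_zigzag (precomp c _) k)) f g

lemma mk_eq_of_iso {a b : B} {f g : a ⟶ b} (e : f ≅ g) :
    (Quotient.mk _ f : ConnectedComponents (a ⟶ b)) = Quotient.mk _ g :=
  Quotient.sound (Zigzag.of_hom e.hom)

instance : Category (LocalPi₀ B) where
  Hom a b := ConnectedComponents (a.of ⟶ b.of)
  id a := Quotient.mk _ (𝟙 a.of)
  comp f g := compPi₀ f g
  id_comp f := by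
    induction f using Quotient.inductionOn with
    | h f => exact mk_eq_of_iso (Bicategory.leftUnitor f)
  comp_id f := by
    induction f using Quotient.inductionOn with
    | h f => exact mk_eq_of_iso (Bicategory.rightUnitor f)
  assoc f g h := by
    induction f using Quotient.inductionOn with
    | h f =>
      induction g using Quotient.inductionOn with
      | h g =>
        induction h using Quotient.inductionOn with
        | h h => exact mk_eq_of_iso (Bicategory.associator f g h)

end LocalQuotient

section Pullbacks

open Bicategory

universe w v u w₁ v₁' u₁' w₂ v₂' u₂' w₃ v₃' u₃' w₄ v₄ u₄

/-- A commutative square of bicategories and pseudofunctors is a (strict) pullback if it has the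
universal property of a pullback with respect to all bicategories and pseudofunctors. -/
def IsPullbackOfBicategories {P : Type u} [Bicategory.{w, v} P] {C : Type u₁'}
    [Bicategory.{w₁, v₁'} C] {D : Type u₂'} [Bicategory.{w₂, v₂'} D] {B : Type u₃'}
    [Bicategory.{w₃, v₃'} B] (F : P ⥤ᵖ C) (G : P ⥤ᵖ D) (S : C ⥤ᵖ B) (T : D ⥤ᵖ B) : Prop :=
  F.comp S = G.comp T ∧
    ∀ (X : Type u₄) [Bicategory.{w₄, v₄} X] (U : X ⥤ᵖ C) (V : X ⥤ᵖ D), U.comp S = V.comp T →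
      ∃! H : X ⥤ᵖ P, H.comp F = U ∧ H.comp G = V

end Pullbacks

section FibreOptics

open Bicategory Opposite

variable {ℐ : Type u₀} [Category.{v₀} ℐ] [CartesianMonoidalCategory ℐ]
  [Limits.HasPullbacks ℐ]
  {𝓜 : Type u₁} [Category.{v₁} 𝓜] [MonoidalCategory 𝓜]
  {𝓒 : Type u₂} [Category.{v₂} 𝓒] [MonoidalLeftAction 𝓜 𝓒]
  {𝓓 : Type u₃} [Category.{v₃} 𝓓] [MonoidalLeftAction 𝓜 𝓓]
  (pM : 𝓜 ⥤ ℐ) [MonoidalBifibration pM] [BeckChevalley pM]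

section

variable (p : 𝓒 ⥤ ℐ) [Bifibration p] [BeckChevalley p] [Fibraction pM p]

/-- The bicategory `Copara`: the Grothendieck construction of matrix-vector multiplication. Its
1-cells `(I, C) ⟶ (J, C')` over a matrix `M` are morphisms `C ⟶ π_I^! (M • π_J^* C')`. -/
abbrev Copara := (groth (MatMult pM p)).Total

/-- The bicategory `Paraᵒᵖ`: the Grothendieck construction of the fibrewise opposite of
matrix-vector multiplication. Its 1-cells `(I, D) ⟶ (J, D')` over a matrix `M` are morphisms
`π_I^! (M • π_J^* D') ⟶ D`. -/
abbrev ParaOp := (grothOp (MatMult pM p)).Total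

/-- The projection of `Copara` to the bicategory of matrices. -/
noncomputable abbrev coparaProj : Copara pM p ⥤ᵖ Mat pM := (groth (MatMult pM p)).proj

/-- The projection of `Paraᵒᵖ` to the bicategory of matrices. -/
noncomputable abbrev paraOpProj : ParaOp pM p ⥤ᵖ Mat pM := (grothOp (MatMult pM p)).proj

end

variable (pC : 𝓒 ⥤ ℐ) [Bifibration pC] [BeckChevalley pC] [Fibraction pM pC]
  (pD : 𝓓 ⥤ ℐ) [Bifibration pD] [BeckChevalley pD] [Fibraction pM pD]

/-- The bicategory of fibre optics, which remembers the residuals: an object is an object `I` of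
`ℐ` with objects of `𝓒_I` and of `𝓓_I`; a 1-cell consists of a matrix `M` and of two morphisms
`C ⟶ π_I^! (M • π_J^* C')` and `π_I^! (M • π_J^* D') ⟶ D`; a 2-cell is a morphism of matrices
compatible with these. -/
abbrev FibOptic₂ := ((groth (MatMult pM pC)).prod (grothOp (MatMult pM pD))).Total

/-- The forward part of a fibre optic. -/
noncomputable abbrev forwards : FibOptic₂ pM pC pD ⥤ᵖ Copara pM pC := Displayed.prodFst _ _

/-- The backward part of a fibre optic. -/
noncomputable abbrev backwards : FibOptic₂ pM pC pD ⥤ᵖ ParaOp pM pD := Displayed.prodSnd _ _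

end FibreOptics

section Optics

open Bicategory Opposite

variable {ℐ : Type u₀} [Category.{v₀} ℐ] [CartesianMonoidalCategory ℐ]
  {𝓜 : Type u₁} [Category.{v₁} 𝓜] [MonoidalCategory 𝓜]
  {𝓒 : Type u₂} [Category.{v₂} 𝓒] [MonoidalLeftAction 𝓜 𝓒]
  {𝓓 : Type u₃} [Category.{v₃} 𝓓] [MonoidalLeftAction 𝓜 𝓓]

/-- Objects of the category of fibre optics: triples of an object `I` of `ℐ`, an object of the
fibre `𝓒_I` and an object of the fibre `𝓓_I`. -/
structure FibOptic (_ : 𝓜 ⥤ ℐ) (pC : 𝓒 ⥤ ℐ) (pD : 𝓓 ⥤ ℐ) where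
  idx : ℐ
  fwd : pC.Fiber idx
  bwd : pD.Fiber idx

variable [Limits.HasPullbacks ℐ]
  {pM : 𝓜 ⥤ ℐ} [MonoidalBifibration pM] [BeckChevalley pM]
  {pC : 𝓒 ⥤ ℐ} [Bifibration pC] [BeckChevalley pC] [Fibraction pM pC]
  {pD : 𝓓 ⥤ ℐ} [Bifibration pD] [BeckChevalley pD] [Fibraction pM pD]

namespace FibOptic

/-- Representatives of fibre optics: elements of `𝓒_I (C, π_I^! (M • π_J^* C')) ×
𝓓_I (π_I^! (M • π_J^* D'), D)` for some residual `M`. -/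
structure Rep (a b : FibOptic pM pC pD) where
  residual : pM.Fiber (a.idx ⊗ b.idx)
  get : a.fwd ⟶ matVec residual b.fwd
  put : matVec residual b.bwd ⟶ a.bwd

/-- The relation defining the coend: a morphism of residuals can be slid from one side to the
other. -/
inductive Slide {a b : FibOptic pM pC pD} : Rep a b → Rep a b → Prop
  | slide {M N : pM.Fiber (a.idx ⊗ b.idx)} (α : M ⟶ N) (f : a.fwd ⟶ matVec M b.fwd)
      (g : matVec N b.bwd ⟶ a.bwd) :
      Slide ⟨M, f, (vecAction pM pD).map α (𝟙 b.bwd) ≫ g⟩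
        ⟨N, f ≫ (vecAction pM pC).map α (𝟙 b.fwd), g⟩

/-- An object of the category of fibre optics as an object of the bicategory of fibre optics. -/
abbrev toBicat (a : FibOptic pM pC pD) : FibOptic₂ pM pC pD := ⟨⟨a.idx⟩, (a.fwd, a.bwd)⟩

/-- The 1-cell given by a representative of a fibre optic. -/
abbrev Rep.toBicat {a b : FibOptic pM pC pD} (r : Rep a b) : a.toBicat ⟶ b.toBicat :=
  Displayed.Hom₁.mk r.residual (r.get, r.put)

lemma Slide.mk {a b : FibOptic pM pC pD} {M N : pM.Fiber (a.idx ⊗ b.idx)} (α : M ⟶ N)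
    {f : a.fwd ⟶ matVec M b.fwd} {f' : a.fwd ⟶ matVec N b.fwd} {g : matVec M b.bwd ⟶ a.bwd}
    {g' : matVec N b.bwd ⟶ a.bwd} (h : f ≫ (vecAction pM pC).map α (𝟙 b.fwd) = f')
    (h' : (vecAction pM pD).map α (𝟙 b.bwd) ≫ g' = g) : Slide ⟨M, f, g⟩ ⟨N, f', g'⟩ := by
  subst h h'
  exact .slide _ _ _

lemma slide_of_hom {a b : FibOptic pM pC pD} {r s : Rep a b} (α : r.toBicat ⟶ s.toBicat) :
    Slide r s :=
  Slide.mk (Displayed.Hom₂.base α) (Displayed.Hom₂.rel α).1 (Displayed.Hom₂.rel α).2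

lemma exists_hom {a b : FibOptic pM pC pD} {r s : Rep a b} (h : Slide r s) :
    Nonempty (r.toBicat ⟶ s.toBicat) := by
  obtain ⟨α, f, g⟩ := h
  exact ⟨⟨α, rfl, rfl⟩⟩

/-- The identity, with the unit matrix as residual. -/
noncomputable def Rep.id (a : FibOptic pM pC pD) : Rep a a where
  residual := matOne pM a.idx
  get := ((vecAction pM pC).unit (matSystem pM) a.fwd).inv
  put := ((vecAction pM pD).unit (matSystem pM) a.bwd).hom

/-- Composition, with the product matrix as residual. -/
noncomputable def Rep.comp {a b c : FibOptic pM pC pD} (r : Rep a b) (s : Rep b c) : Rep a c where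
  residual := matMul r.residual s.residual
  get := r.get ≫ (vecAction pM pC).map (𝟙 r.residual) s.get ≫
    ((vecAction pM pC).assoc (matSystem pM) r.residual s.residual c.fwd).inv
  put := ((vecAction pM pD).assoc (matSystem pM) r.residual s.residual c.bwd).hom ≫
    (vecAction pM pD).map (𝟙 r.residual) s.put ≫ r.put

lemma Rep.comp_toBicat {a b c : FibOptic pM pC pD} (r : Rep a b) (s : Rep b c) :
    (r.comp s).toBicat = r.toBicat ≫ s.toBicat := rfl

lemma Rep.id_toBicat (a : FibOptic pM pC pD) : (Rep.id a).toBicat = 𝟙 a.toBicat := rfl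

/-- The category of fibre optics. Its hom-sets are the coends of
`𝓒_I (C, π_I^! (M • π_J^* C')) × 𝓓_I (π_I^! (M • π_J^* D'), D)` over the residual `M`. -/
noncomputable instance : Category (FibOptic pM pC pD) where
  Hom a b := Quot (Slide (a := a) (b := b))
  id a := Quot.mk _ (Rep.id a)
  comp f g := Quot.map₂ Rep.comp
    (fun r _ _ h => (exists_hom h).elim fun α => slide_of_hom (r.toBicat ◁ α))
    (fun _ _ s h => (exists_hom h).elim fun α => slide_of_hom (α ▷ s.toBicat)) f g
  id_comp f := by
    obtain ⟨r⟩ := f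
    exact Quot.sound (slide_of_hom (Bicategory.leftUnitor r.toBicat).hom)
  comp_id f := by
    obtain ⟨r⟩ := f
    exact Quot.sound (slide_of_hom (Bicategory.rightUnitor r.toBicat).hom)
  assoc f g h := by
    obtain ⟨r⟩ := f
    obtain ⟨s⟩ := g
    obtain ⟨t⟩ := h
    exact Quot.sound (slide_of_hom (Bicategory.associator r.toBicat s.toBicat t.toBicat).hom)

/-- The fibre optic with a given representative. -/
abbrev ofRep {a b : FibOptic pM pC pD} (r : Rep a b) : a ⟶ b := Quot.mk _ r

/-- The functor `(M, N) ↦ 𝓒_I (C, π_I^! (N • π_J^* C')) × 𝓓_I (π_I^! (M • π_J^* D'), D)`. -/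
noncomputable def integrand (a b : FibOptic pM pC pD) :
    (pM.Fiber (a.idx ⊗ b.idx))ᵒᵖ ⥤ pM.Fiber (a.idx ⊗ b.idx) ⥤ Type (max u₁ v₂ v₃) where
  obj M :=
    { obj N := ULift.{u₁} ((a.fwd ⟶ matVec N b.fwd) × (matVec M.unop b.bwd ⟶ a.bwd))
      map α := ↾fun x => ⟨x.down.1 ≫ (vecAction pM pC).map α (𝟙 b.fwd), x.down.2⟩
      map_id N := by
        refine ConcreteCategory.hom_ext _ _ fun x => ?_
        refine congrArg (fun y => ULift.up (y, x.down.2)) ?_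
        exact (congrArg (x.down.1 ≫ ·) (MatAction.map_id _ _ _)).trans (Category.comp_id _)
      map_comp α β := by
        refine ConcreteCategory.hom_ext _ _ fun x => ?_
        refine congrArg (fun y => ULift.up (y, x.down.2)) ?_
        exact (congrArg (x.down.1 ≫ ·) (MatAction.map_comp_left _ _ _ _)).trans
          (Category.assoc _ _ _).symm }
  map α :=
    { app N := ↾fun x => ⟨x.down.1, (vecAction pM pD).map α.unop (𝟙 b.bwd) ≫ x.down.2⟩
      naturality _ _ _ := rfl }
  map_id M := by
    refine NatTrans.ext (funext fun N => ConcreteCategory.hom_ext _ _ fun x => ?_)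
    refine congrArg (fun y => ULift.up (x.down.1, y)) ?_
    exact (congrArg (· ≫ x.down.2) (MatAction.map_id _ _ _)).trans (Category.id_comp _)
  map_comp α β := by
    refine NatTrans.ext (funext fun N => ConcreteCategory.hom_ext _ _ fun x => ?_)
    refine congrArg (fun y => ULift.up (x.down.1, y)) ?_
    exact (congrArg (· ≫ x.down.2) (MatAction.map_comp_left _ _ _ _)).trans
      (Category.assoc _ _ _)

/-- The hom-set of fibre optics as a cowedge over the integrand. -/
noncomputable def cowedge (a b : FibOptic pM pC pD) : Limits.Cowedge (integrand a b) :=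
  Limits.Cowedge.mk (a ⟶ b) (fun M => ↾fun x => ofRep ⟨M, x.down.1, x.down.2⟩) (fun _ _ α => by
    refine ConcreteCategory.hom_ext _ _ fun x => ?_
    exact Quot.sound (.slide α x.down.1 x.down.2))

variable (pM pC pD) in
/-- The canonical functor from the category of fibre optics to the local quotient of the bicategory
of fibre optics; it sends the class of `(M, f, g)` to the connected component of `(M, f, g)`. -/
noncomputable def toLocalPi₀ : FibOptic pM pC pD ⥤ LocalPi₀ (FibOptic₂ pM pC pD) where
  obj a := ⟨a.toBicat⟩
  map {a b} f := Quot.lift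
    (fun r : Rep a b => (Quotient.mk _ r.toBicat : ConnectedComponents (a.toBicat ⟶ b.toBicat)))
    (fun _ _ h => (exists_hom h).elim fun α => Quotient.sound (Zigzag.of_hom α)) f
  map_id _ := rfl
  map_comp f g := by
    obtain ⟨r⟩ := f
    obtain ⟨s⟩ := g
    rfl

end FibOptic

end Optics
end FibreOptics

open FibreOptics

/-!
The bicategories `Copara` and `Paraᵒᵖ` are total bicategories of displayed data over the bicategory
of matrices, and `FibOptic₂` is the total bicategory of the product of these data. Since a 2-cell of
a total bicategory is a 2-cell of the base with a property, a pseudofunctor `X ⥤ᵖ 𝒟.Total` is the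
same as a pseudofunctor `G : X ⥤ᵖ B` together with a lift of `G`: a choice of objects and 1-cells
over those of `G`, for which the 2-cells and coherence isomorphisms of `G` have the required
property (`Displayed.Lift`). A lift to `𝒟.prod 𝒟'` is a pair of lifts to `𝒟` and `𝒟'`. Two
pseudofunctors with equal composites to `B` can be regarded as lifts of one and the same `G`
(`Displayed.exists_lift_lift`), and therefore determine a unique pseudofunctor to the total
bicategory of the product (`Displayed.isPullbackOfBicategories_prod`). The composite of a
pseudofunctor with a projection has coherence isomorphisms that are composed with identities, so
that equalities such as `Displayed.comp_proj` hold only propositionally.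

For the local quotient, a 2-cell between 1-cells of `FibOptic₂` is precisely a morphism of residuals
that slides one representative to the other. So connected components of 1-cells are the classes of
the equivalence relation generated by sliding (`FibOptic.ofRep_eq_of_zigzag`), and this is the
relation by which the coend of sets is a quotient of a disjoint union
(`FibOptic.cowedgeIsColimit`).
-/

namespace FibreOptics

/-! ### Pseudofunctors into total bicategories -/

section Lifts

open Bicategory

universe w v u x y x' y' w₄ v₄ u₄

variable {B : Type u} [Bicategory.{w, v} B] {X : Type u₄} [Bicategory.{w₄, v₄} X]

lemma pseudofunctor_eq_of_prelaxFunctor_eq {F G : X ⥤ᵖ B}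
    (h : F.toPrelaxFunctor = G.toPrelaxFunctor) (hid : ∀ a, F.mapId a ≍ G.mapId a)
    (hcomp : ∀ {a b c : X} (f : a ⟶ b) (g : b ⟶ c), F.mapComp f g ≍ G.mapComp f g) : F = G := by
  cases F
  cases G
  dsimp only at h hid hcomp
  subst h
  congr 1
  · funext a
    exact eq_of_heq (hid a)
  · funext a b c f g
    exact eq_of_heq (hcomp f g)

namespace Displayed

/-- A lift of a pseudofunctor `G : X ⥤ᵖ B` to the total bicategory of displayed data over `B`.
Since the 2-cells of the total bicategory carry no data beyond their projections, a lift consists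
of objects and 1-cells over those of `G`, such that the 2-cells and the coherence isomorphisms of
`G` lift. -/
structure Lift (𝒟 : Displayed.{w, v, u, x, y} B) (G : X ⥤ᵖ B) where
  ob (a : X) : 𝒟.Ob (G.obj a)
  hm {a b : X} (f : a ⟶ b) : 𝒟.Hm (G.map f) (ob a) (ob b)
  rel₂ {a b : X} {f g : a ⟶ b} (α : f ⟶ g) : 𝒟.Rel (G.map₂ α) (hm f) (hm g)
  rel_mapId (a : X) : 𝒟.Rel (G.mapId a).hom (hm (𝟙 a)) (𝒟.id (ob a)) ∧
    𝒟.Rel (G.mapId a).inv (𝒟.id (ob a)) (hm (𝟙 a))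
  rel_mapComp {a b c : X} (f : a ⟶ b) (g : b ⟶ c) :
    𝒟.Rel (G.mapComp f g).hom (hm (f ≫ g)) (𝒟.comp (hm f) (hm g)) ∧
      𝒟.Rel (G.mapComp f g).inv (𝒟.comp (hm f) (hm g)) (hm (f ≫ g))

variable {𝒟 : Displayed.{w, v, u, x, y} B} {𝒟' : Displayed.{w, v, u, x', y'} B}

/-- The invertible 2-cell of the base under an invertible 2-cell of the total bicategory. -/
def baseIso {a b : 𝒟.Total} {f g : a ⟶ b} (e : f ≅ g) : f.base ≅ g.base where
  hom := Hom₂.base e.hom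
  inv := Hom₂.base e.inv
  hom_inv_id := congrArg Hom₂.base e.hom_inv_id
  inv_hom_id := congrArg Hom₂.base e.inv_hom_id

/-- The pseudofunctor under a pseudofunctor to the total bicategory. It equals the composite with
the projection, but its coherence isomorphisms are not composed with identities. -/
def under (U : X ⥤ᵖ 𝒟.Total) : X ⥤ᵖ B where
  obj a := (U.obj a).base
  map f := (U.map f).base
  map₂ α := Hom₂.base (U.map₂ α)
  map₂_id f := congrArg Hom₂.base (U.map₂_id f)
  map₂_comp α β := congrArg Hom₂.base (U.map₂_comp α β)
  mapId a := baseIso (U.mapId a)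
  mapComp f g := baseIso (U.mapComp f g)
  map₂_whisker_left f _ _ α := congrArg Hom₂.base (U.map₂_whisker_left f α)
  map₂_whisker_right α h := congrArg Hom₂.base (U.map₂_whisker_right α h)
  map₂_associator f g h := congrArg Hom₂.base (U.map₂_associator f g h)
  map₂_left_unitor f := congrArg Hom₂.base (U.map₂_left_unitor f)
  map₂_right_unitor f := congrArg Hom₂.base (U.map₂_right_unitor f)

/-- A pseudofunctor to the total bicategory as a lift of the pseudofunctor under it. -/
def toLift (U : X ⥤ᵖ 𝒟.Total) : 𝒟.Lift (under U) where
  ob a := (U.obj a).fib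
  hm f := (U.map f).fib
  rel₂ α := Hom₂.rel (U.map₂ α)
  rel_mapId a := ⟨Hom₂.rel (U.mapId a).hom, Hom₂.rel (U.mapId a).inv⟩
  rel_mapComp f g := ⟨Hom₂.rel (U.mapComp f g).hom, Hom₂.rel (U.mapComp f g).inv⟩

lemma comp_proj (U : X ⥤ᵖ 𝒟.Total) : U.comp 𝒟.proj = under U :=
  pseudofunctor_eq_of_prelaxFunctor_eq rfl
    (fun _ => heq_of_eq (Iso.ext (Category.comp_id _)))
    (fun _ _ => heq_of_eq (Iso.ext (Category.comp_id _)))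

namespace Lift

variable {G : X ⥤ᵖ B}

/-- The pseudofunctor to the total bicategory given by a lift. -/
def total (L : 𝒟.Lift G) : X ⥤ᵖ 𝒟.Total where
  obj a := ⟨G.obj a, L.ob a⟩
  map f := Hom₁.mk (G.map f) (L.hm f)
  map₂ α := Hom₂.mk (G.map₂ α) (L.rel₂ α)
  map₂_id f := Hom₂.ext (G.map₂_id f)
  map₂_comp α β := Hom₂.ext (G.map₂_comp α β)
  mapId a := isoMk (G.mapId a) (L.rel_mapId a)
  mapComp f g := isoMk (G.mapComp f g) (L.rel_mapComp f g)
  map₂_whisker_left f _ _ α := Hom₂.ext (G.map₂_whisker_left f α)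
  map₂_whisker_right α h := Hom₂.ext (G.map₂_whisker_right α h)
  map₂_associator f g h := Hom₂.ext (G.map₂_associator f g h)
  map₂_left_unitor f := Hom₂.ext (G.map₂_left_unitor f)
  map₂_right_unitor f := Hom₂.ext (G.map₂_right_unitor f)

lemma total_toLift (U : X ⥤ᵖ 𝒟.Total) : (toLift U).total = U := rfl

lemma total_injective : Function.Injective (total : 𝒟.Lift G → X ⥤ᵖ 𝒟.Total) := by
  intro L L' h
  -- As `toLift` inverts `total` definitionally, it only has to be applied to both sides, together
  -- with the pseudofunctor on which its type depends.
  have h' : (⟨under L.total, toLift L.total⟩ : Σ G : X ⥤ᵖ B, 𝒟.Lift G) =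
      ⟨under L'.total, toLift L'.total⟩ := by rw [h]
  exact eq_of_heq (Sigma.mk.inj h').2

/-- The lift to a fibre product given by lifts to the factors. -/
def prod (L : 𝒟.Lift G) (L' : 𝒟'.Lift G) : (𝒟.prod 𝒟').Lift G where
  ob a := (L.ob a, L'.ob a)
  hm f := (L.hm f, L'.hm f)
  rel₂ α := ⟨L.rel₂ α, L'.rel₂ α⟩
  rel_mapId a := ⟨⟨(L.rel_mapId a).1, (L'.rel_mapId a).1⟩, (L.rel_mapId a).2, (L'.rel_mapId a).2⟩
  rel_mapComp f g := ⟨⟨(L.rel_mapComp f g).1, (L'.rel_mapComp f g).1⟩,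
    (L.rel_mapComp f g).2, (L'.rel_mapComp f g).2⟩

/-- The first component of a lift to a fibre product. -/
def fst (L : (𝒟.prod 𝒟').Lift G) : 𝒟.Lift G where
  ob a := (L.ob a).1
  hm f := (L.hm f).1
  rel₂ α := (L.rel₂ α).1
  rel_mapId a := ⟨(L.rel_mapId a).1.1, (L.rel_mapId a).2.1⟩
  rel_mapComp f g := ⟨(L.rel_mapComp f g).1.1, (L.rel_mapComp f g).2.1⟩

/-- The second component of a lift to a fibre product. -/
def snd (L : (𝒟.prod 𝒟').Lift G) : 𝒟'.Lift G where
  ob a := (L.ob a).2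
  hm f := (L.hm f).2
  rel₂ α := (L.rel₂ α).2
  rel_mapId a := ⟨(L.rel_mapId a).1.2, (L.rel_mapId a).2.2⟩
  rel_mapComp f g := ⟨(L.rel_mapComp f g).1.2, (L.rel_mapComp f g).2.2⟩

lemma prod_fst_snd (L : (𝒟.prod 𝒟').Lift G) : L.fst.prod L.snd = L := rfl

lemma total_comp_prodFst (L : (𝒟.prod 𝒟').Lift G) :
    L.total.comp (𝒟.prodFst 𝒟') = L.fst.total :=
  pseudofunctor_eq_of_prelaxFunctor_eq rfl
    (fun _ => heq_of_eq (Iso.ext (Category.comp_id _)))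
    (fun _ _ => heq_of_eq (Iso.ext (Category.comp_id _)))

lemma total_comp_prodSnd (L : (𝒟.prod 𝒟').Lift G) :
    L.total.comp (𝒟.prodSnd 𝒟') = L.snd.total :=
  pseudofunctor_eq_of_prelaxFunctor_eq rfl
    (fun _ => heq_of_eq (Iso.ext (Category.comp_id _)))
    (fun _ _ => heq_of_eq (Iso.ext (Category.comp_id _)))

end Lift

lemma prodFst_comp_proj :
    (𝒟.prodFst 𝒟').comp 𝒟.proj = (𝒟.prodSnd 𝒟').comp 𝒟'.proj :=
  pseudofunctor_eq_of_prelaxFunctor_eq rfl (fun _ => HEq.rfl) (fun _ _ => HEq.rfl)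

/-- Two pseudofunctors with the same projection to `B` are lifts of a common pseudofunctor. -/
lemma exists_lift_lift (U : X ⥤ᵖ 𝒟.Total) (V : X ⥤ᵖ 𝒟'.Total)
    (h : U.comp 𝒟.proj = V.comp 𝒟'.proj) :
    ∃ (G : X ⥤ᵖ B) (L : 𝒟.Lift G) (L' : 𝒟'.Lift G), L.total = U ∧ L'.total = V := by
  rw [comp_proj, comp_proj] at h
  suffices ∀ (G : X ⥤ᵖ B) (L : 𝒟.Lift G), G = under V →
      ∃ L' : 𝒟'.Lift G, L'.total = V from
    ⟨under U, toLift U, (this _ (toLift U) h).choose, rfl, (this _ (toLift U) h).choose_spec⟩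
  rintro _ _ rfl
  exact ⟨toLift V, rfl⟩

/-- The projections of a fibre product are jointly monic on pseudofunctors. -/
lemma hom_ext_prod {H H' : X ⥤ᵖ (𝒟.prod 𝒟').Total}
    (h₁ : H.comp (𝒟.prodFst 𝒟') = H'.comp (𝒟.prodFst 𝒟'))
    (h₂ : H.comp (𝒟.prodSnd 𝒟') = H'.comp (𝒟.prodSnd 𝒟')) : H = H' := by
  have h : H.comp (𝒟.prod 𝒟').proj = H'.comp (𝒟.prod 𝒟').proj := by
    have e (K : X ⥤ᵖ (𝒟.prod 𝒟').Total) :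
        K.comp (𝒟.prod 𝒟').proj = under (K.comp (𝒟.prodFst 𝒟')) := by
      rw [comp_proj, ← Lift.total_toLift K, Lift.total_comp_prodFst]
      rfl
    rw [e, e, h₁]
  obtain ⟨G, L, L', rfl, rfl⟩ := exists_lift_lift H H' h
  rw [Lift.total_comp_prodFst, Lift.total_comp_prodFst] at h₁
  rw [Lift.total_comp_prodSnd, Lift.total_comp_prodSnd] at h₂
  rw [← L.prod_fst_snd, ← L'.prod_fst_snd, Lift.total_injective h₁, Lift.total_injective h₂]

variable (𝒟 𝒟') in
/-- The fibre product of displayed data presents the strict pullback of total bicategories. -/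
theorem isPullbackOfBicategories_prod :
    IsPullbackOfBicategories (𝒟.prodFst 𝒟') (𝒟.prodSnd 𝒟') 𝒟.proj
      𝒟'.proj := by
  refine ⟨prodFst_comp_proj, fun X _ U V h => ?_⟩
  obtain ⟨G, L, L', rfl, rfl⟩ := exists_lift_lift U V h
  exact ⟨(L.prod L').total, ⟨Lift.total_comp_prodFst _, Lift.total_comp_prodSnd _⟩,
    fun H hH => hom_ext_prod (hH.1.trans (Lift.total_comp_prodFst (L.prod L')).symm)
      (hH.2.trans (Lift.total_comp_prodSnd (L.prod L')).symm)⟩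

end Displayed

end Lifts

/-! ### Fibre optics as connected components and as coends -/

namespace FibOptic

variable {ℐ : Type u₀} [Category.{v₀} ℐ] [CartesianMonoidalCategory ℐ]
  {𝓜 : Type u₁} [Category.{v₁} 𝓜] [MonoidalCategory 𝓜]
  {𝓒 : Type u₂} [Category.{v₂} 𝓒] [MonoidalLeftAction 𝓜 𝓒]
  {𝓓 : Type u₃} [Category.{v₃} 𝓓] [MonoidalLeftAction 𝓜 𝓓]
  [Limits.HasPullbacks ℐ]
  {pM : 𝓜 ⥤ ℐ} [MonoidalBifibration pM] [BeckChevalley pM]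
  {pC : 𝓒 ⥤ ℐ} [Bifibration pC] [BeckChevalley pC] [Fibraction pM pC]
  {pD : 𝓓 ⥤ ℐ} [Bifibration pD] [BeckChevalley pD] [Fibraction pM pD]

/-- An object of the bicategory of fibre optics as an object of the category of fibre optics. -/
abbrev ofBicat (a : FibOptic₂ pM pC pD) : FibOptic pM pC pD := ⟨a.base.idx, a.fib.1, a.fib.2⟩

/-- The representative of a fibre optic given by a 1-cell. -/
abbrev Rep.ofBicat {a b : FibOptic₂ pM pC pD} (f : a ⟶ b) :
    Rep (FibOptic.ofBicat a) (FibOptic.ofBicat b) :=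
  ⟨f.base, f.fib.1, f.fib.2⟩

/-- Optics in the same connected component are equal, as each 2-cell is a slide. -/
lemma ofRep_eq_of_zigzag {a b : FibOptic₂ pM pC pD} {f g : a ⟶ b} (h : Zigzag f g) :
    ofRep (Rep.ofBicat f) = ofRep (Rep.ofBicat g) := by
  induction h with
  | refl => rfl
  | tail _ h ih =>
    refine ih.trans ?_
    obtain ⟨⟨α⟩⟩ | ⟨⟨α⟩⟩ := h
    · exact Quot.sound (slide_of_hom α)
    · exact (Quot.sound (slide_of_hom α)).symm

variable (pM pC pD) in
/-- The functor from the local quotient of the bicategory of fibre optics to the category of fibre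
optics; it sends the connected component of `(M, f, g)` to the class of `(M, f, g)`. -/
noncomputable def ofLocalPi₀ : LocalPi₀ (FibOptic₂ pM pC pD) ⥤ FibOptic pM pC pD where
  obj a := ofBicat a.of
  map {a b} f := Quotient.lift (fun f : a.of ⟶ b.of => ofRep (Rep.ofBicat f))
    (fun _ _ h => ofRep_eq_of_zigzag h) f
  map_id _ := rfl
  map_comp f g := by
    obtain ⟨f⟩ := f
    obtain ⟨g⟩ := g
    rfl

lemma toLocalPi₀_comp_ofLocalPi₀ : toLocalPi₀ pM pC pD ⋙ ofLocalPi₀ pM pC pD = 𝟭 _ :=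
  Functor.hext (fun _ => rfl) (fun _ _ f => by
    obtain ⟨r⟩ := f
    rfl)

lemma ofLocalPi₀_comp_toLocalPi₀ : ofLocalPi₀ pM pC pD ⋙ toLocalPi₀ pM pC pD = 𝟭 _ :=
  Functor.hext (fun _ => rfl) (fun _ _ f => by
    obtain ⟨f⟩ := f
    rfl)

/-- The coend of the integrand is the quotient of the representatives by sliding. -/
noncomputable def cowedgeIsColimit (a b : FibOptic pM pC pD) :
    Limits.IsColimit (cowedge a b) :=
  Limits.Multicofork.IsColimit.mk _
    (fun s => ↾fun q => Quot.lift (fun r : Rep a b => s.π r.residual ⟨r.get, r.put⟩)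
      (by
        rintro _ _ ⟨α, f, g⟩
        exact ConcreteCategory.congr_hom (Limits.Cowedge.condition s α) ⟨f, g⟩) q)
    (fun _ _ => rfl)
    (fun s m hm => by
      refine ConcreteCategory.hom_ext _ _ fun q => ?_
      obtain ⟨r⟩ := q
      exact ConcreteCategory.congr_hom (hm r.residual) ⟨r.get, r.put⟩)

end FibOptic

end FibreOptics

theorem mainTheorem5
    {ℐ : Type u₀} [Category.{v₀} ℐ] [CartesianMonoidalCategory ℐ] [Limits.HasFiniteLimits ℐ]
    {𝓜 : Type u₁} [Category.{v₁} 𝓜] [MonoidalCategory 𝓜]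
    {𝓒 : Type u₂} [Category.{v₂} 𝓒] [MonoidalCategory 𝓒] [MonoidalLeftAction 𝓜 𝓒]
    {𝓓 : Type u₃} [Category.{v₃} 𝓓] [MonoidalCategory 𝓓] [MonoidalLeftAction 𝓜 𝓓]
    (pM : 𝓜 ⥤ ℐ) [MonoidalBifibration pM] [BeckChevalley pM]
    (pC : 𝓒 ⥤ ℐ) [MonoidalBifibration pC] [BeckChevalley pC] [Fibraction pM pC]
    (pD : 𝓓 ⥤ ℐ) [MonoidalBifibration pD] [BeckChevalley pD] [Fibraction pM pD] :
    IsPullbackOfBicategories (forwards pM pC pD) (backwards pM pC pD)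
        (coparaProj pM pC) (paraOpProj pM pD) ∧
      (∃ Ψ : LocalPi₀ (FibOptic₂ pM pC pD) ⥤ FibOptic pM pC pD,
        FibOptic.toLocalPi₀ pM pC pD ⋙ Ψ = 𝟭 _ ∧ Ψ ⋙ FibOptic.toLocalPi₀ pM pC pD = 𝟭 _) ∧
      ∀ a b : FibOptic pM pC pD, Nonempty (Limits.IsColimit (FibOptic.cowedge a b)) := by
  exact ⟨Displayed.isPullbackOfBicategories_prod _ _,
    ⟨FibOptic.ofLocalPi₀ pM pC pD, FibOptic.toLocalPi₀_comp_ofLocalPi₀,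
      FibOptic.ofLocalPi₀_comp_toLocalPi₀⟩,
    fun a b => ⟨FibOptic.cowedgeIsColimit a b⟩⟩
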